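/- Let $k$ be a field. A left bialgebroid $(U,A,s,t,\Delta,\epsilon)$ over $k$ consists of unital $k$-algebras $A$, $U$, $k$-algebra morphisms $s:A\to U$ and $t:A^{op}\to U$ with commuting images, and a coalgebra $(U,\Delta:U\to U\otimes_{A}U,\epsilon:U\to A)$ in $(A,A)$-bimodules, where $U$ has the bimodule structure $a\cdot u\cdot b=s(a)t(b)u$, such that $\Delta$ takes values in the Takeuchi product $U\times_AU=\{\sum u_i\otimes u_i' : \sum u_it(a)\otimes u_i'=\sum u_i\otimes u_i's(a)\ \forall a\in A\}$, $\Delta:U\to U\times_AU$ is a morphism of unital $k$-algebras, and $\epsilon(us(\epsilon(u')))=\epsilon(uu')=\epsilon(ut(\epsilon(u')))$. Write $\Delta(u)=u_{(1)}\otimes u_{(2)}$. A Hopf algebroid $\mathcal U=(U,A,s,t,\Delta,\epsilon,S)$ is a left bialgebroid with an anti-automorphism $S$ of the $k$-algebra $U$ such that $S^2=\mathrm{id}$, $S\circ t=s$, and, in $U\otimes_AU$, $$S(u_{(1)})_{(1)}u_{(2)}\otimes S(u_{(1)})_{(2)}=1\otimes S(u),\qquad S(u_{(2)})_{(1)}\otimes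 S(u_{(2)})_{(2)}u_{(1)}=S(u)\otimes 1 .$$ Let $C_\bullet(\mathcal U)$ be the cyclic module of $\mathcal U$: put $A_R=A^{op}$, $s_R=t$, $\epsilon_R=\epsilon\circ S$, regard $U$ as an $(A_R,A_R)$-bimodule by $a\cdot u\cdot b=s_R(a)\,u\,s_R(b)$, and let $C_0(\mathcal U)=A_R$ and $C_n(\mathcal U)=U\otimes_{A_R}\cdots\otimes_{A_R}U$ ($n$ factors, $n\ge 1$). For $n\ge 2$ the faces $d_i:C_n(\mathcal U)\to C_{n-1}(\mathcal U)$ send $u^1\otimes\cdots\otimes u^n$ to $\epsilon_R(u^1)\cdot u^2\otimes\cdots\otimes u^n$ for $i=0$, to $u^1\otimes\cdots\otimes u^iu^{i+1}\otimes\cdots\otimes u^n$ for $1\le i\le n-1$, and to $u^1\otimes\cdots\otimes u^{n-1}\cdot\epsilon_R(S(u^n))$ for $i=n$; on $C_1(\mathcal U)=U$, $d_0=\epsilon_R$ and $d_1=\epsilon_R\circ S$. For $0\le i\le n$ the degeneracy $s_i:C_n(\mathcal U)\to C_{n+1}(\mathcal U)$ inserts $1$ after the $i$-th factor (for $n=0$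 it is $s_R:A_R\to U$). The cyclic operators are $t_0=\mathrm{id}$ and $$t_n(u^1\otimes\cdots\otimes u^n)=S(u^1_{(2)}\cdots u^{n-1}_{(2)}u^n)\otimes u^1_{(1)}\otimes\cdots\otimes u^{n-1}_{(1)}\qquad(n\ge1).$$ $HH_\bullet(\mathcal U)$ is the homology of $C_\bullet(\mathcal U)$ with the boundary $b=\sum_i(-1)^id_i$, and $HC_\bullet(\mathcal U)$ is the homology of the total complex of the (first quadrant) cyclic bicomplex of $C_\bullet(\mathcal U)$. Let $\mathcal U,\mathcal U'$ be Hopf algebroids over $k$ and let $C$ be a cocommutative $k$-coalgebra. A $C$-measuring $(\Psi,\psi)$ from $\mathcal U$ to $\mathcal U'$ consists of $k$-linear maps $\Psi:C\to\mathrm{Hom}_k(U,U')$ and $\psi:C\to\mathrm{Hom}_k(A,A')$, with $\Psi(x)$ and $\psi(x)$ both written as $x$, which satisfy $x(ab)=x_{(1)}(a)x_{(2)}(b)$ and $x(1)=\epsilon_C(x)1$, and such that for each $x\in C$ $$x\circ s=s'\circ x,\quad x\circ t=t'\circ x,\quad x\circ S=S'\circ x,\quad x\circ\epsilon=\epsilon'\circ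 x,\quad \Delta'(x(u))=x_{(1)}(u_{(1)})\otimes x_{(2)}(u_{(2)})\ \ (u\in U).$$ **Proposition.** Let $(\Psi,\psi)$ be such a $C$-measuring. For each $x\in C$ there are well-defined linear maps $\underline\Psi_n(x):C_n(\mathcal U)\to C_n(\mathcal U')$, $n\ge0$, with $\underline\Psi_0(x)=\psi(x)$ and $$\underline\Psi_n(x)(u^1\otimes\cdots\otimes u^n)=x_{(1)}(u^1)\otimes\cdots\otimes x_{(n)}(u^n)\qquad(n\ge1),$$ and they give a morphism of cyclic modules $C_\bullet(\mathcal U)\to C_\bullet(\mathcal U')$, that is, they commute with all faces, degeneracies and cyclic operators. In particular, the maps $\underline\Psi_\bullet(x)$ induce linear maps $HH_n(\mathcal U)\to HH_n(\mathcal U')$ and $HC_n(\mathcal U)\to HC_n(\mathcal U')$ for all $n\ge0$. -/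

import Mathlib

open scoped TensorProduct

universe u v w

noncomputable section

namespace HopfMeas

/-! ## Tensor products over a noncommutative ring -/

section Balanced

variable {k : Type*} [Field k] {A M N P : Type*}
  [AddCommGroup M] [Module k M] [AddCommGroup N] [Module k N] [AddCommGroup P] [Module k P]

/-- The relations `(m · a) ⊗ n = m ⊗ (a · n)` in `M ⊗[k] N`, where `m · a` is `r a m` and
`a · n` is `l a n`. -/
def balRel (r : A → M →ₗ[k] M) (l : A → N →ₗ[k] N) : Submodule k (M ⊗[k] N) :=
  Submodule.span k {z | ∃ a m n, z = r a m ⊗ₜ[k] n - m ⊗ₜ[k] l a n}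

/-- The tensor product `M ⊗_A N` of a right `A`-module `M` (with action `m · a = r a m`) and a
left `A`-module `N` (with action `a · n = l a n`), as a quotient of `M ⊗[k] N`. -/
abbrev BalTensor (r : A → M →ₗ[k] M) (l : A → N →ₗ[k] N) : Type _ :=
  (M ⊗[k] N) ⧸ balRel r l

namespace BalTensor

/-- The pure tensor `m ⊗_A n`. -/
def mk (r : A → M →ₗ[k] M) (l : A → N →ₗ[k] N) : M →ₗ[k] N →ₗ[k] BalTensor r l :=
  (TensorProduct.mk k M N).compr₂ (balRel r l).mkQ

variable {r : A → M →ₗ[k] M} {l : A → N →ₗ[k] N}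

theorem mk_balanced (a : A) (m : M) (n : N) : mk r l (r a m) n = mk r l m (l a n) :=
  (Submodule.Quotient.eq _).2 (Submodule.subset_span ⟨a, m, n, rfl⟩)

/-- The linear map out of `M ⊗_A N` given by a balanced bilinear map. -/
def lift (f : M →ₗ[k] N →ₗ[k] P) (h : ∀ a m n, f (r a m) n = f m (l a n)) :
    BalTensor r l →ₗ[k] P :=
  (balRel r l).liftQ (TensorProduct.lift f) (Submodule.span_le.2 (by
    rintro _ ⟨a, m, n, rfl⟩
    simp [h]))

@[simp]
theorem lift_mk (f : M →ₗ[k] N →ₗ[k] P) (h : ∀ a m n, f (r a m) n = f m (l a n)) (m : M) (n : N) :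
    lift f h (mk r l m n) = f m n := rfl

theorem hom_ext {f g : BalTensor r l →ₗ[k] P} (h : ∀ m n, f (mk r l m n) = g (mk r l m n)) :
    f = g := by
  apply Submodule.linearMap_qext
  apply TensorProduct.ext'
  intro m n
  exact h m n

theorem apply_ext {f g : BalTensor r l →ₗ[k] P}
    (h : ∀ m n, f (mk r l m n) = g (mk r l m n)) (z : BalTensor r l) : f z = g z :=
  LinearMap.congr_fun (hom_ext h) z

end BalTensor

end Balanced

/-! ## Bialgebroids and Hopf algebroids -/

/-- An `(s, t)`-ring over `A`: a `k`-algebra `U` with algebra morphisms `s : A → U` and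
`t : Aᵒᵖ → U` whose images commute. -/
structure STRing (k : Type*) [Field k] (A U : Type*) [Ring A] [Algebra k A] [Ring U]
    [Algebra k U] where
  /-- the source map -/
  s : A →ₐ[k] U
  /-- the target map -/
  t : Aᵐᵒᵖ →ₐ[k] U
  s_t_comm : ∀ a b, s a * t b = t b * s a

namespace STRing

variable {k : Type*} [Field k] {A U : Type*} [Ring A] [Algebra k A] [Ring U] [Algebra k U]
  (R : STRing k A U)

/-- The target map as a function of `a : A`. -/
def tgt (a : A) : U := R.t (MulOpposite.op a)

/-- The left `A_L`-action `a · u = s(a) u`. -/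
def lAct (a : A) : U →ₗ[k] U := LinearMap.mulLeft k (R.s a)

/-- The right `A_L`-action `u · a = t(a) u`. -/
def rAct (a : A) : U →ₗ[k] U := LinearMap.mulLeft k (R.tgt a)

/-- `U ⊗_{A_L} U`, for the bimodule structure `a · u · b = s(a) t(b) u`. -/
abbrev TensorL : Type _ := BalTensor R.rAct R.lAct

/-- The pure tensor `u ⊗ v` in `U ⊗_{A_L} U`. -/
abbrev tmulL : U →ₗ[k] U →ₗ[k] R.TensorL := BalTensor.mk R.rAct R.lAct

/-- The canonical projection `U ⊗_k U → U ⊗_{A_L} U`. -/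
abbrev toTensorL : U ⊗[k] U →ₗ[k] R.TensorL := (balRel R.rAct R.lAct).mkQ

/-- `p ⊗ q ↦ s(a) p ⊗ t(b) q` on `U ⊗_{A_L} U`: the bimodule structure `a · z · b`. -/
def bimodL (a b : A) : R.TensorL →ₗ[k] R.TensorL :=
  BalTensor.lift (R.tmulL.compl₁₂ (LinearMap.mulLeft k (R.s a)) (LinearMap.mulLeft k (R.tgt b)))
    (by
      intro c m n
      have h := BalTensor.mk_balanced (r := R.rAct) (l := R.lAct) c (R.s a * m) (R.tgt b * n)
      simp only [rAct, lAct, tgt, LinearMap.mulLeft_apply, LinearMap.compl₁₂_apply] at h ⊢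
      rw [← mul_assoc, R.s_t_comm, mul_assoc, h, ← mul_assoc, R.s_t_comm, mul_assoc])

@[simp]
theorem bimodL_tmulL (a b : A) (p q : U) :
    R.bimodL a b (R.tmulL p q) = R.tmulL (R.s a * p) (R.tgt b * q) := rfl

/-- The right multiplication `p ⊗ q ↦ p v ⊗ q w` on `U ⊗_{A_L} U`. -/
def rmulL (v w : U) : R.TensorL →ₗ[k] R.TensorL :=
  BalTensor.lift (R.tmulL.compl₁₂ (LinearMap.mulRight k v) (LinearMap.mulRight k w)) (by
    intro c m n
    have h := BalTensor.mk_balanced (r := R.rAct) (l := R.lAct) c (m * v) (n * w)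
    simpa only [rAct, lAct, tgt, LinearMap.mulLeft_apply, LinearMap.mulRight_apply,
      LinearMap.compl₁₂_apply, mul_assoc] using h)

@[simp]
theorem rmulL_tmulL (v w p q : U) : R.rmulL v w (R.tmulL p q) = R.tmulL (p * v) (q * w) := by
  simp [rmulL]

/-- `rmulL v w z` is also linear in `v` and `w`. -/
def rmulL₂ (z : R.TensorL) : U →ₗ[k] U →ₗ[k] R.TensorL :=
  LinearMap.mk₂ k (fun v w => R.rmulL v w z)
    (fun v v' w => by
      rw [← LinearMap.add_apply]; congr 1
      apply BalTensor.hom_ext; intro p q; simp [mul_add])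
    (fun c v w => by
      rw [← LinearMap.smul_apply]; congr 1
      apply BalTensor.hom_ext; intro p q; simp)
    (fun v w w' => by
      rw [← LinearMap.add_apply]; congr 1
      apply BalTensor.hom_ext; intro p q; simp [mul_add])
    (fun c v w => by
      rw [← LinearMap.smul_apply]; congr 1
      apply BalTensor.hom_ext; intro p q; simp)

/-- The Takeuchi product `U ×_{A_L} U ⊆ U ⊗_{A_L} U`: the `∑ p ⊗ q` with
`∑ p t(a) ⊗ q = ∑ p ⊗ q s(a)` for all `a`. -/
def takeuchi : Submodule k R.TensorL where
  carrier := {z | ∀ a, R.rmulL (R.tgt a) 1 z = R.rmulL 1 (R.s a) z}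
  add_mem' := fun h h' a => by simp [h a, h' a]
  zero_mem' := fun a => by simp
  smul_mem' := fun c z h a => by simp [h a]

/-- `z` and `X = ∑ v ⊗ w` are sent to `∑ z (v ⊗ w)`. For `z` in the Takeuchi product this only
depends on the class of `X` in `U ⊗_{A_L} U`, and for `X` representing an element of the
Takeuchi product it is the product there. -/
def mulRep (z : R.TensorL) : U ⊗[k] U →ₗ[k] R.TensorL := TensorProduct.lift (R.rmulL₂ z)

/-- The left `A_L`-action `a · (p ⊗ q) = s(a) p ⊗ q` on `U ⊗_{A_L} U`. -/
def lActL (a : A) : R.TensorL →ₗ[k] R.TensorL := R.bimodL a 1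

/-- `U ⊗_{A_L} (U ⊗_{A_L} U)`. -/
abbrev TensorL₃ : Type _ := BalTensor R.rAct R.lActL

/-- `(p ⊗ q, w) ↦ p ⊗ (q ⊗ w)`: the reassociation `(U ⊗_{A_L} U) ⊗ U → U ⊗_{A_L} (U ⊗_{A_L} U)`. -/
def assocL : R.TensorL →ₗ[k] U →ₗ[k] R.TensorL₃ :=
  BalTensor.lift
    (LinearMap.mk₂ k
      (fun p q => (BalTensor.mk R.rAct R.lActL p).comp (R.tmulL q))
      (fun p p' q => by ext w; simp) (fun c p q => by ext w; simp)
      (fun p q q' => by ext w; simp) (fun c p q => by ext w; simp))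
    (by
      intro a p q
      ext w
      have h := BalTensor.mk_balanced (r := R.rAct) (l := R.lActL) a p (R.tmulL q w)
      simpa [lActL, bimodL, lAct, tgt] using h)

end STRing

/-- A left bialgebroid `(U, A_L, s_L, t_L, Δ_L, ε_L)` over `k`. Sweedler sums
`Δ(u) = u₍₁₎ ⊗ u₍₂₎` are written by means of an arbitrary `X : U ⊗_k U` which represents `Δ(u)`. -/
structure LeftBialgebroid (k : Type*) [Field k] (A U : Type*) [Ring A] [Algebra k A] [Ring U]
    [Algebra k U] extends STRing k A U where
  /-- the coproduct `Δ_L` -/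
  Δ : U →ₗ[k] toSTRing.TensorL
  /-- the counit `ε_L` -/
  ε : U →ₗ[k] A
  /-- `Δ_L` is a morphism of `(A, A)`-bimodules -/
  Δ_bimod : ∀ a b u, Δ (s a * toSTRing.tgt b * u) = toSTRing.bimodL a b (Δ u)
  /-- `ε_L` is a morphism of `(A, A)`-bimodules -/
  ε_bimod : ∀ a b u, ε (s a * toSTRing.tgt b * u) = a * ε u * b
  /-- `(Δ ⊗ id) Δ = (id ⊗ Δ) Δ` -/
  coassoc : ∀ u X, toSTRing.toTensorL X = Δ u →
    TensorProduct.lift (toSTRing.assocL.comp Δ) X =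
      TensorProduct.lift ((BalTensor.mk toSTRing.rAct toSTRing.lActL).compl₂ Δ) X
  /-- `s(ε(u₍₁₎)) u₍₂₎ = u` -/
  counit_left : ∀ u X, toSTRing.toTensorL X = Δ u →
    TensorProduct.lift ((LinearMap.mul k U).comp (s.toLinearMap.comp ε)) X = u
  /-- `t(ε(u₍₂₎)) u₍₁₎ = u` -/
  counit_right : ∀ u X, toSTRing.toTensorL X = Δ u →
    TensorProduct.lift ((LinearMap.mul k U).comp
      ((t.toLinearMap.comp (MulOpposite.opLinearEquiv k).toLinearMap).comp ε)).flip X = u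
  /-- `Δ_L` takes values in the Takeuchi product -/
  Δ_mem : ∀ u, Δ u ∈ toSTRing.takeuchi
  Δ_one : Δ 1 = toSTRing.tmulL 1 1
  /-- `Δ_L(u v) = Δ_L(u) Δ_L(v)` -/
  Δ_mul : ∀ u v X, toSTRing.toTensorL X = Δ v → Δ (u * v) = toSTRing.mulRep (Δ u) X
  ε_mul_s : ∀ u v, ε (u * s (ε v)) = ε (u * v)
  ε_mul_t : ∀ u v, ε (u * toSTRing.tgt (ε v)) = ε (u * v)

/-- A Hopf algebroid over `k` (with involutive antipode). -/
structure HopfAlgebroid (k : Type*) [Field k] (A U : Type*) [Ring A] [Algebra k A] [Ring U]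
    [Algebra k U] extends LeftBialgebroid k A U where
  /-- the antipode -/
  S : U →ₗ[k] U
  S_mul : ∀ u v, S (u * v) = S v * S u
  S_one : S 1 = 1
  S_S : ∀ u, S (S u) = u
  S_t : ∀ a, S (toSTRing.tgt a) = s a
  /-- `S(u₍₁₎)₍₁₎ u₍₂₎ ⊗ S(u₍₁₎)₍₂₎ = 1 ⊗ S(u)` -/
  antipode_left : ∀ u X, toSTRing.toTensorL X = Δ u →
    TensorProduct.lift (LinearMap.mk₂ k (fun p q => toSTRing.rmulL₂ (Δ (S p)) q 1)
      (fun p p' q => by simp [STRing.rmulL₂]) (fun c p q => by simp [STRing.rmulL₂])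
      (fun p q q' => by simp) (fun c p q => by simp)) X = toSTRing.tmulL 1 (S u)
  /-- `S(u₍₂₎)₍₁₎ ⊗ S(u₍₂₎)₍₂₎ u₍₁₎ = S(u) ⊗ 1` -/
  antipode_right : ∀ u X, toSTRing.toTensorL X = Δ u →
    TensorProduct.lift (LinearMap.mk₂ k (fun p q => toSTRing.rmulL₂ (Δ (S q)) 1 p)
      (fun p p' q => by simp) (fun c p q => by simp)
      (fun p q q' => by simp [STRing.rmulL₂]) (fun c p q => by simp [STRing.rmulL₂])) X =
        toSTRing.tmulL (S u) 1

/-! ## Measurings -/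

section Measuring

variable {k : Type*} [Field k] {C : Type*} [AddCommGroup C] [Module k C] [Coalgebra k C]

/-- `Ψ` is a measuring of algebras: `x(a b) = x₍₁₎(a) x₍₂₎(b)` and `x(1) = ε(x) 1`. -/
structure IsMeasuring {R R' : Type*} [Ring R] [Algebra k R] [Ring R'] [Algebra k R']
    (Ψ : C →ₗ[k] R →ₗ[k] R') : Prop where
  map_mul : ∀ x a b, Ψ x (a * b) =
    LinearMap.mul' k R' (TensorProduct.map (Ψ.flip a) (Ψ.flip b) (Coalgebra.comul (R := k) x))
  map_one : ∀ x, Ψ x 1 = Coalgebra.counit (R := k) x • (1 : R')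

/-- The action `p ⊗ q ↦ x₍₁₎(p) ⊗ x₍₂₎(q)` of `x`, from `U ⊗_k U` to `U' ⊗_k U'`. -/
def diagAct {U U' : Type*} [AddCommGroup U] [Module k U] [AddCommGroup U'] [Module k U']
    (Ψ : C →ₗ[k] U →ₗ[k] U') (x : C) : U ⊗[k] U →ₗ[k] U' ⊗[k] U' :=
  TensorProduct.lift ((TensorProduct.mapBilinear (RingHom.id k) U U U' U').compl₁₂ Ψ Ψ)
    (Coalgebra.comul (R := k) x)

/-- A `C`-measuring `(Ψ, ψ)` between Hopf algebroids. -/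
structure Measuring {A U A' U' : Type*} [Ring A] [Algebra k A] [Ring U] [Algebra k U]
    [Ring A'] [Algebra k A'] [Ring U'] [Algebra k U']
    (H : HopfAlgebroid k A U) (H' : HopfAlgebroid k A' U')
    (C : Type*) [AddCommGroup C] [Module k C] [Coalgebra k C] where
  /-- the measuring of total algebras -/
  Ψ : C →ₗ[k] U →ₗ[k] U'
  /-- the measuring of base algebras -/
  ψ : C →ₗ[k] A →ₗ[k] A'
  measΨ : IsMeasuring Ψ
  measψ : IsMeasuring ψ
  map_s : ∀ x a, Ψ x (H.s a) = H'.s (ψ x a)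
  map_t : ∀ x a, Ψ x (H.tgt a) = H'.tgt (ψ x a)
  map_S : ∀ x u, Ψ x (H.S u) = H'.S (Ψ x u)
  map_ε : ∀ x u, ψ x (H.ε u) = H'.ε (Ψ x u)
  /-- `Δ'(x(u)) = x₍₁₎(u₍₁₎) ⊗ x₍₂₎(u₍₂₎)` -/
  map_Δ : ∀ x u X, H.toTensorL X = H.Δ u → H'.Δ (Ψ x u) = H'.toTensorL (diagAct Ψ x X)

end Measuring

/-! ## Cyclic operators, Hochschild and cyclic homology -/

/-- The cycles in degree `n` of `⋯ → X 2 → X 1 → X 0 → 0`. -/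
def cycles {k : Type*} [Field k] {X : ℕ → Type*} [∀ n, AddCommGroup (X n)] [∀ n, Module k (X n)]
    (d : ∀ n, X (n + 1) →ₗ[k] X n) : ∀ n, Submodule k (X n)
  | 0 => ⊤
  | n + 1 => LinearMap.ker (d n)

/-- The homology in degree `n` of `⋯ → X 2 → X 1 → X 0 → 0`: cycles modulo boundaries. -/
abbrev Homology {k : Type*} [Field k] {X : ℕ → Type*} [∀ n, AddCommGroup (X n)]
    [∀ n, Module k (X n)] (d : ∀ n, X (n + 1) →ₗ[k] X n) (n : ℕ) : Type _ :=
  cycles d n ⧸ (LinearMap.range (d n)).submoduleOf (cycles d n)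

/-- The family `φ` induces a map on the homology in degree `n`: it maps cycles to cycles, and
there is a linear map of homologies sending the class of each cycle `z` to the class of `φ z`. -/
def InducesOnHomology {k : Type*} [Field k] {X Y : ℕ → Type*} [∀ n, AddCommGroup (X n)]
    [∀ n, Module k (X n)] [∀ n, AddCommGroup (Y n)] [∀ n, Module k (Y n)]
    (d : ∀ n, X (n + 1) →ₗ[k] X n) (d' : ∀ n, Y (n + 1) →ₗ[k] Y n)
    (φ : ∀ n, X n →ₗ[k] Y n) (n : ℕ) : Prop :=
  ∃ f : Homology d n →ₗ[k] Homology d' n, ∀ z : cycles d n, ∃ hz : φ n z ∈ cycles d' n,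
    f (Submodule.Quotient.mk z) = Submodule.Quotient.mk ⟨φ n z, hz⟩

/-- Vector spaces `X n`, `n ≥ 0`, with the operators of a cyclic module: faces
`d i : X (n + 1) → X n` for `0 ≤ i ≤ n + 1`, degeneracies `s i : X n → X (n + 1)` for
`0 ≤ i ≤ n`, and cyclic operators `t : X n → X n`. The cyclic identities are not recorded here:
morphisms, and homologies as cycles modulo boundaries, only refer to the operators. -/
structure CyclicOperators (k : Type*) [Field k] where
  X : ℕ → Type w
  [addCommGroup : ∀ n, AddCommGroup (X n)]
  [module : ∀ n, Module k (X n)]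
  d : ∀ n, Fin (n + 2) → X (n + 1) →ₗ[k] X n
  s : ∀ n, Fin (n + 1) → X n →ₗ[k] X (n + 1)
  t : ∀ n, X n →ₗ[k] X n

attribute [instance] CyclicOperators.addCommGroup CyclicOperators.module

namespace CyclicOperators

variable {k : Type*} [Field k] (Z : CyclicOperators.{w} k)

/-- The Hochschild boundary `b = ∑_{i = 0}^{n + 1} (-1)^i d_i` on `X (n + 1)`. -/
def b (n : ℕ) : Z.X (n + 1) →ₗ[k] Z.X n :=
  ∑ i : Fin (n + 2), (-1 : k) ^ (i : ℕ) • Z.d n i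

/-- The operator `b' = ∑_{i = 0}^n (-1)^i d_i` on `X (n + 1)`, which omits the last face. -/
def b' (n : ℕ) : Z.X (n + 1) →ₗ[k] Z.X n :=
  ∑ i : Fin (n + 1), (-1 : k) ^ (i : ℕ) • Z.d n i.castSucc

/-- The signed cyclic operator `(-1)^n t` on `X n`. -/
def sgnT (n : ℕ) : Z.X n →ₗ[k] Z.X n := (-1 : k) ^ n • Z.t n

/-- The norm operator `∑_{i = 0}^n ((-1)^n t)^i` on `X n`. -/
def norm (n : ℕ) : Z.X n →ₗ[k] Z.X n := ∑ i ∈ Finset.range (n + 1), Z.sgnT n ^ i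

/-- Degree `n` of the total complex of the cyclic bicomplex `CC_{p, q} = X q`, `p, q ≥ 0`. The
component of index `q ≤ n` is the one in bidegree `(n - q, q)`. -/
abbrev Tot (n : ℕ) : Type w := ∀ q : Fin (n + 1), Z.X q

/-- The differential of the total complex of the cyclic bicomplex: the vertical maps are `b` in
the even columns and `-b'` in the odd ones, and the horizontal maps are `1 - (-1)^q t` from odd
to even columns and the norm operator from even to odd columns. -/
def totD (n : ℕ) : Z.Tot (n + 1) →ₗ[k] Z.Tot n :=
  LinearMap.pi fun q : Fin (n + 1) =>
    if Even (n - (q : ℕ)) then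
      (Z.b q).comp (LinearMap.proj (φ := fun j : Fin (n + 2) => Z.X j) q.succ) +
        (LinearMap.id - Z.sgnT q).comp
          (LinearMap.proj (φ := fun j : Fin (n + 2) => Z.X j) q.castSucc)
    else
      -(Z.b' q).comp (LinearMap.proj (φ := fun j : Fin (n + 2) => Z.X j) q.succ) +
        (Z.norm q).comp (LinearMap.proj (φ := fun j : Fin (n + 2) => Z.X j) q.castSucc)

/-- Hochschild homology. -/
abbrev HH (n : ℕ) : Type w := Homology Z.b n

/-- Cyclic homology. -/
abbrev HC (n : ℕ) : Type w := Homology (X := Z.Tot) Z.totD n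

variable {Z} {Z' : CyclicOperators.{v} k}

/-- The family `φ` is a morphism of cyclic modules: it commutes with all faces, degeneracies and
cyclic operators. -/
structure IsMorphism (φ : ∀ n, Z.X n →ₗ[k] Z'.X n) : Prop where
  map_d : ∀ n i z, φ n (Z.d n i z) = Z'.d n i (φ (n + 1) z)
  map_s : ∀ n i z, φ (n + 1) (Z.s n i z) = Z'.s n i (φ n z)
  map_t : ∀ n z, φ n (Z.t n z) = Z'.t n (φ n z)

/-- The map which `φ` gives on the total complexes, componentwise. -/
def totMap (φ : ∀ n, Z.X n →ₗ[k] Z'.X n) (n : ℕ) : Z.Tot n →ₗ[k] Z'.Tot n :=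
  LinearMap.pi fun q : Fin (n + 1) =>
    (φ q).comp (LinearMap.proj (φ := fun j : Fin (n + 1) => Z.X j) q)

end CyclicOperators

/-! ## The cyclic module of a Hopf algebroid -/

/-- A `k`-vector space with a left action of the `k`-algebra `U`. -/
structure LeftMod (k : Type*) [Field k] (U : Type u) [Ring U] [Algebra k U] where
  carrier : Type u
  [addCommGroup : AddCommGroup carrier]
  [module : Module k carrier]
  act : U →ₐ[k] Module.End k carrier

attribute [instance] LeftMod.addCommGroup LeftMod.module

namespace HopfAlgebroid

variable {k : Type*} [Field k] {A U : Type u} [Ring A] [Algebra k A] [Ring U] [Algebra k U]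
  (H : HopfAlgebroid k A U)

theorem S_s (a : A) : H.S (H.s a) = H.tgt a := by rw [← H.S_t, H.S_S]

theorem tgt_mul (a b : A) : H.tgt (a * b) = H.tgt b * H.tgt a := by simp [STRing.tgt]

theorem tgt_one : H.tgt 1 = 1 := by simp [STRing.tgt]

/-- The target map as a linear map; this is `s_R : A_R → U`. -/
def sR : A →ₗ[k] U := H.t.toLinearMap.comp (MulOpposite.opLinearEquiv k).toLinearMap

@[simp] theorem sR_apply (a : A) : H.sR a = H.tgt a := rfl

/-- `ε_R = ε_L ∘ S`. -/
def εR : U →ₗ[k] A := H.ε.comp H.S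

/-- The right `A_R`-action `u · a = u s_R(a)` on `U`. -/
def rActR (a : A) : U →ₗ[k] U := LinearMap.mulRight k (H.sR a)

/-- The left `A_R`-action on `N` by `a · n = s_R(a) n`. -/
def lActR (N : LeftMod k U) (a : A) : N.carrier →ₗ[k] N.carrier := N.act (H.sR a)

/-- `U ⊗_{A_R} N`. -/
abbrev TensorR (N : LeftMod k U) : Type u := BalTensor H.rActR (H.lActR N)

/-- The pure tensor `u ⊗ n` in `U ⊗_{A_R} N`. -/
abbrev tmulR (N : LeftMod k U) : U →ₗ[k] N.carrier →ₗ[k] H.TensorR N :=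
  BalTensor.mk H.rActR (H.lActR N)

theorem tmulR_balanced (N : LeftMod k U) (a : A) (p : U) (n : N.carrier) :
    H.tmulR N (p * H.tgt a) n = H.tmulR N p (N.act (H.tgt a) n) :=
  BalTensor.mk_balanced (r := H.rActR) (l := H.lActR N) a p n

/-- The left multiplication `v (u ⊗ n) = v u ⊗ n`. -/
def lmulR (N : LeftMod k U) (v : U) : H.TensorR N →ₗ[k] H.TensorR N :=
  BalTensor.lift ((H.tmulR N).comp (LinearMap.mulLeft k v)) (by
    intro a m n
    have h := H.tmulR_balanced N a (v * m) n
    simpa [rActR, lActR, mul_assoc] using h)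

@[simp]
theorem lmulR_tmulR (N : LeftMod k U) (v p : U) (n : N.carrier) :
    H.lmulR N v (H.tmulR N p n) = H.tmulR N (v * p) n := by
  simp [lmulR]

/-- `U` as a left module over itself. -/
abbrev baseMod (k : Type*) [Field k] (U : Type u) [Ring U] [Algebra k U] : LeftMod k U where
  carrier := U
  act := Algebra.lmul k U

/-- `U ⊗_{A_R} N` as a left `U`-module. -/
abbrev tensorMod (N : LeftMod k U) : LeftMod k U where
  carrier := H.TensorR N
  act := AlgHom.ofLinearMap
    { toFun := H.lmulR N
      map_add' := fun v w => by
        apply BalTensor.hom_ext; intro p n; simp [add_mul]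
      map_smul' := fun c v => by
        apply BalTensor.hom_ext; intro p n; simp }
    (by apply BalTensor.hom_ext; intro p n; simp)
    (fun v w => by apply BalTensor.hom_ext; intro p n; simp [mul_assoc])

theorem tensorMod_act (N : LeftMod k U) (v : U) : (H.tensorMod N).act v = H.lmulR N v := rfl

theorem lmulR_hom {P : Type*} [AddCommGroup P] [Module k P] (N : LeftMod k U)
    (f : H.TensorR N →ₗ[k] P) (e : P →ₗ[k] P) (v : U)
    (h : ∀ p n, f (H.tmulR N (v * p) n) = e (f (H.tmulR N p n))) (z : H.TensorR N) :
    f (H.lmulR N v z) = e (f z) :=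
  BalTensor.apply_ext (f := f.comp (H.lmulR N v)) (g := e.comp f)
    (fun p n => by rw [LinearMap.comp_apply, lmulR_tmulR, h]; rfl) z

/-- The linear maps `N → N'` that commute with the left actions of `A_R`. -/
def HomR (N N' : LeftMod k U) : Type u :=
  {f : N.carrier →ₗ[k] N'.carrier //
    ∀ a n, f (N.act (H.tgt a) n) = N'.act (H.tgt a) (f n)}

/-- `id ⊗ f : U ⊗_{A_R} N → U ⊗_{A_R} N'`. -/
def idTensor {N N' : LeftMod k U} (f : H.HomR N N') : H.HomR (H.tensorMod N) (H.tensorMod N') :=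
  ⟨BalTensor.lift ((H.tmulR N').compl₂ f.1) (by
      intro a m n
      have h := H.tmulR_balanced N' a m (f.1 n)
      simpa [rActR, lActR, f.2] using h), fun a z => by
    rw [tensorMod_act, tensorMod_act, ← LinearMap.comp_apply, ← LinearMap.comp_apply]
    congr 1
    apply BalTensor.hom_ext
    intro p n
    simp⟩

/-- The face `d_0 (u ⊗ n) = ε_R(u) · n`. -/
def faceZero (N : LeftMod k U) : H.TensorR N →ₗ[k] N.carrier :=
  BalTensor.lift ((N.act.toLinearMap.comp H.sR).comp H.εR) (by
    intro a m c
    have h : H.ε (H.S (m * H.tgt a)) = a * H.ε (H.S m) := by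
      have := H.ε_bimod a 1 (H.S m)
      rw [H.tgt_one, mul_one, mul_one] at this
      rw [H.S_mul, H.S_t, this]
    simp [rActR, lActR, εR, h, H.tgt_mul])

/-- The multiplication `u ⊗ n ↦ u n`. -/
def faceOne (N : LeftMod k U) : H.HomR (H.tensorMod N) N :=
  ⟨BalTensor.lift N.act.toLinearMap (by
      intro a m c
      simp [rActR, lActR]), fun a => H.lmulR_hom N _ (N.act (H.tgt a)) _ fun p n => by
    change N.act (H.tgt a * p) n = N.act (H.tgt a) (N.act p n)
    rw [map_mul]
    rfl⟩

/-- The last face `u ⊗ v ↦ u · ε_R(S(v))` of `U ⊗_{A_R} U`. -/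
def faceLast : H.HomR (H.tensorMod (baseMod k U)) (baseMod k U) :=
  ⟨BalTensor.lift ((LinearMap.mul k U).compl₂ (H.sR.comp (H.εR.comp H.S))) (by
      intro a m c
      have h : H.ε (H.tgt a * c) = H.ε c * a := by
        have := H.ε_bimod 1 a c
        simpa using this
      change m * H.tgt a * H.tgt (H.ε (H.S (H.S c))) =
        m * H.tgt (H.ε (H.S (H.S (H.tgt a * c))))
      rw [H.S_S, H.S_S, h, H.tgt_mul, mul_assoc]), fun a =>
    H.lmulR_hom (baseMod k U) _ ((baseMod k U).act (H.tgt a)) _ fun p n => mul_assoc _ _ _⟩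

/-- The degeneracy `s_0 (n) = 1 ⊗ n`. -/
def degenZero (N : LeftMod k U) : H.HomR N (H.tensorMod N) :=
  ⟨H.tmulR N 1, fun a n => by
    rw [tensorMod_act, lmulR_tmulR, ← tmulR_balanced, one_mul, mul_one]⟩

/-- The degeneracy `s_1 (u) = u ⊗ 1` on `U`. -/
def degenLast : H.HomR (baseMod k U) (H.tensorMod (baseMod k U)) :=
  ⟨(H.tmulR (baseMod k U)).flip (1 : U), fun a p => by
    rw [tensorMod_act, LinearMap.flip_apply, LinearMap.flip_apply, lmulR_tmulR]
    rfl⟩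

/-- `pow n = U ⊗_{A_R} (U ⊗_{A_R} (⋯ ⊗_{A_R} U))`, with `n + 1` factors. -/
def pow : ℕ → LeftMod k U
  | 0 => baseMod k U
  | n + 1 => H.tensorMod (pow n)

/-- The pure tensor `u ⊗ c` in `U ⊗_{A_R} U^{⊗ (n + 1)} = U^{⊗ (n + 2)}`. -/
def cons (n : ℕ) : U →ₗ[k] (H.pow n).carrier →ₗ[k] (H.pow (n + 1)).carrier :=
  H.tmulR (H.pow n)

/-- The pure tensor `u 0 ⊗ u 1 ⊗ ⋯ ⊗ u n`. -/
def tprod : ∀ n, (Fin (n + 1) → U) → (H.pow n).carrier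
  | 0, u => u 0
  | n + 1, u => H.cons n (u 0) (tprod n (Fin.tail u))

/-- The faces `d_1, …, d_{n + 2}` of `U^{⊗ (n + 2)}`, as `facePos n 0, …, facePos n (n + 1)`.
They are given by `d_1 (u ⊗ c) = u c` (that is, `u¹ ⊗ u² ⊗ ⋯ ↦ u¹ u² ⊗ ⋯`), by
`d_2 (u ⊗ v) = u · ε_R(S(v))` on `U ⊗_{A_R} U`, and by `d_{i + 1} (u ⊗ c) = u ⊗ d_i(c)` for
`i ≥ 1`. -/
def facePos : ∀ n, ℕ → H.HomR (H.pow (n + 1)) (H.pow n)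
  | n, 0 => H.faceOne (H.pow n)
  | 0, _ + 1 => H.faceLast
  | n + 1, j + 1 => H.idTensor (facePos n j)

/-- The degeneracies `s_0, …, s_{n + 1}` of `U^{⊗ (n + 1)}`. They are given by `s_0(c) = 1 ⊗ c`,
by `s_1(u) = u ⊗ 1` on `U`, and by `s_{i + 1} (u ⊗ c) = u ⊗ s_i(c)`. -/
def degenPow : ∀ n, ℕ → H.HomR (H.pow n) (H.pow (n + 1))
  | n, 0 => H.degenZero (H.pow n)
  | 0, _ + 1 => H.degenLast
  | n + 1, j + 1 => H.idTensor (degenPow n j)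

/-- `U ⊗ N` for a left `U`-module `N`, modulo the relations `s_L(a) v ⊗ n = v ⊗ t_L(a) n`. -/
abbrev TensorFlip (N : LeftMod k U) : Type u := BalTensor H.lAct (H.lActR N)

/-- The pure tensor `v ⊗ n` in `TensorFlip N`. -/
abbrev tmulFlip (N : LeftMod k U) : U →ₗ[k] N.carrier →ₗ[k] H.TensorFlip N :=
  BalTensor.mk H.lAct (H.lActR N)

theorem tmulFlip_balanced (N : LeftMod k U) (a : A) (v : U) (n : N.carrier) :
    H.tmulFlip N (H.s a * v) n = H.tmulFlip N v (N.act (H.tgt a) n) :=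
  BalTensor.mk_balanced (r := H.lAct) (l := H.lActR N) a v n

/-- The left action `v ⊗ n ↦ t(a) v ⊗ n` on `TensorFlip N`. -/
def tgtFlip (N : LeftMod k U) (a : A) : H.TensorFlip N →ₗ[k] H.TensorFlip N :=
  BalTensor.lift ((H.tmulFlip N).comp (LinearMap.mulLeft k (H.tgt a))) (by
    intro c v n
    have h := H.tmulFlip_balanced N c (H.tgt a * v) n
    rw [← mul_assoc, show H.s c * H.tgt a = H.tgt a * H.s c from H.s_t_comm _ _, mul_assoc] at h
    simpa [STRing.lAct, lActR] using h)

/-- The linear maps `f : N → TensorFlip N'` with `f(t(a) n) = t(a) f(n)`. -/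
def HomFlip (N N' : LeftMod k U) : Type u :=
  {f : N.carrier →ₗ[k] H.TensorFlip N' // ∀ a n, f (N.act (H.tgt a) n) = H.tgtFlip N' a (f n)}

@[simp]
theorem tgtFlip_tmulFlip (N : LeftMod k U) (a : A) (v : U) (n : N.carrier) :
    H.tgtFlip N a (H.tmulFlip N v n) = H.tmulFlip N (H.tgt a * v) n := rfl

/-- For fixed `v, n`, the map `p ⊗ q ↦ q v ⊗ (p ⊗ n)`. -/
def splitAux (N : LeftMod k U) (v : U) (n : N.carrier) :
    H.TensorL →ₗ[k] H.TensorFlip (H.tensorMod N) :=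
  BalTensor.lift
    (((H.tmulFlip (H.tensorMod N)).compl₁₂ (LinearMap.mulRight k v) ((H.tmulR N).flip n)).flip) (by
      intro a p q
      have h := H.tmulFlip_balanced (H.tensorMod N) a (q * v) (H.tmulR N p n)
      rw [tensorMod_act, lmulR_tmulR] at h
      simpa [STRing.lAct, STRing.rAct, mul_assoc] using h.symm)

@[simp]
theorem splitAux_tmulL (N : LeftMod k U) (v : U) (n : N.carrier) (p q : U) :
    H.splitAux N v n (H.tmulL p q) = H.tmulFlip (H.tensorMod N) (q * v) (H.tmulR N p n) := rfl

/-- For fixed `v`, the map `p ⊗ q ↦ q v ⊗ p`. -/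
def splitAux₀ (v : U) : H.TensorL →ₗ[k] H.TensorFlip (baseMod k U) :=
  BalTensor.lift
    (((H.tmulFlip (baseMod k U)).comp (LinearMap.mulRight k v)).flip) (by
      intro a p q
      have h := H.tmulFlip_balanced (baseMod k U) a (q * v) p
      simpa [STRing.lAct, STRing.rAct, mul_assoc] using h.symm)

@[simp]
theorem splitAux₀_tmulL (v : U) (p q : U) :
    H.splitAux₀ v (H.tmulL p q) = H.tmulFlip (baseMod k U) (q * v) p := rfl

theorem Δ_tgt (a : A) : H.Δ (H.tgt a) = H.tmulL 1 (H.tgt a) := by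
  have h := H.Δ_bimod 1 a 1
  rw [H.Δ_one] at h
  simpa [STRing.bimodL] using h

theorem Δ_mul_tgt (u : U) (a : A) : H.Δ (u * H.tgt a) = H.rmulL 1 (H.tgt a) (H.Δ u) := by
  rw [H.Δ_mul u (H.tgt a) (1 ⊗ₜ H.tgt a) (H.Δ_tgt a).symm]
  rfl

theorem Δ_tgt_mul (u : U) (a : A) : H.Δ (H.tgt a * u) = H.bimodL 1 a (H.Δ u) := by
  have h := H.Δ_bimod 1 a u
  simpa using h

theorem splitAux₀_mul_tgt (u v : U) (a : A) :
    H.splitAux₀ v (H.Δ (u * H.tgt a)) = H.splitAux₀ (H.tgt a * v) (H.Δ u) := by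
  rw [Δ_mul_tgt]
  refine BalTensor.apply_ext (f := (H.splitAux₀ v).comp (H.rmulL 1 (H.tgt a)))
    (fun p q => ?_) _
  rw [LinearMap.comp_apply, STRing.rmulL_tmulL, splitAux₀_tmulL, splitAux₀_tmulL, mul_one,
    mul_assoc]

theorem splitAux₀_tgt_mul (u v : U) (a : A) :
    H.splitAux₀ v (H.Δ (H.tgt a * u)) = H.tgtFlip (baseMod k U) a (H.splitAux₀ v (H.Δ u)) := by
  rw [Δ_tgt_mul]
  refine BalTensor.apply_ext (f := (H.splitAux₀ v).comp (H.bimodL 1 a))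
    (g := (H.tgtFlip (baseMod k U) a).comp (H.splitAux₀ v)) (fun p q => ?_) _
  rw [LinearMap.comp_apply, LinearMap.comp_apply, STRing.bimodL_tmulL, splitAux₀_tmulL,
    splitAux₀_tmulL, map_one, one_mul, mul_assoc]
  exact (H.tgtFlip_tmulFlip (baseMod k U) a (q * v) p).symm

/-- The bilinear map `(u, v) ↦ u₍₂₎ v ⊗ u₍₁₎`. -/
def splitBil₀ : U →ₗ[k] U →ₗ[k] H.TensorFlip (baseMod k U) :=
  LinearMap.mk₂ k (fun u v => H.splitAux₀ v (H.Δ u))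
    (fun u u' v => by simp) (fun c u v => by simp)
    (fun u v v' => BalTensor.apply_ext (f := H.splitAux₀ (v + v'))
      (g := H.splitAux₀ v + H.splitAux₀ v') (fun p q => by simp [mul_add]) _)
    (fun c u v => BalTensor.apply_ext (f := H.splitAux₀ (c • v))
      (g := c • H.splitAux₀ v) (fun p q => by simp) _)

theorem splitBil₀_apply (u v : U) : H.splitBil₀ u v = H.splitAux₀ v (H.Δ u) := rfl

theorem splitBil₀_balanced (a : A) (u v : U) :
    H.splitBil₀ (H.rActR a u) v = H.splitBil₀ u (H.lActR (baseMod k U) a v) := by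
  rw [show H.rActR a u = u * H.tgt a from rfl,
    show H.lActR (baseMod k U) a v = H.tgt a * v from rfl, splitBil₀_apply, splitBil₀_apply]
  exact H.splitAux₀_mul_tgt u v a

/-- The map `u ⊗ v ↦ u₍₂₎ v ⊗ u₍₁₎` on `U ⊗_{A_R} U`. -/
def splitBaseMap : H.TensorR (baseMod k U) →ₗ[k] H.TensorFlip (baseMod k U) :=
  BalTensor.lift H.splitBil₀ H.splitBil₀_balanced

theorem splitBaseMap_tmulR (u v : U) :
    H.splitBaseMap (H.tmulR (baseMod k U) u v) = H.splitAux₀ v (H.Δ u) :=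
  (BalTensor.lift_mk H.splitBil₀ H.splitBil₀_balanced u v).trans (H.splitBil₀_apply u v)

theorem splitBaseMap_lmulR (a : A) (z : H.TensorR (baseMod k U)) :
    H.splitBaseMap (H.lmulR (baseMod k U) (H.tgt a) z) =
      H.tgtFlip (baseMod k U) a (H.splitBaseMap z) :=
  H.lmulR_hom (baseMod k U) H.splitBaseMap (H.tgtFlip (baseMod k U) a) (H.tgt a)
    (fun u v => (H.splitBaseMap_tmulR (H.tgt a * u) v).trans ((H.splitAux₀_tgt_mul u v a).trans
      (congrArg (H.tgtFlip (baseMod k U) a) (H.splitBaseMap_tmulR u v).symm))) z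

/-- `splitBaseMap`, with its compatibility with the left action of `A_R`. -/
def splitBase : H.HomFlip (H.tensorMod (baseMod k U)) (baseMod k U) :=
  ⟨H.splitBaseMap, H.splitBaseMap_lmulR⟩

/-- For fixed `u`, the map `v ⊗ n ↦ u₍₂₎ v ⊗ (u₍₁₎ ⊗ n)`. It is well defined since `Δ_L(u)` lies
in the Takeuchi product. -/
def splitMap (N : LeftMod k U) (u : U) :
    H.TensorFlip N →ₗ[k] H.TensorFlip (H.tensorMod N) :=
  BalTensor.lift (LinearMap.mk₂ k (fun v n => H.splitAux N v n (H.Δ u))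
    (fun v v' n => by
      rw [← LinearMap.add_apply]; congr 1
      apply BalTensor.hom_ext; intro p q; simp [mul_add])
    (fun c v n => by
      rw [← LinearMap.smul_apply]; congr 1
      apply BalTensor.hom_ext; intro p q; simp)
    (fun v n n' => by
      rw [← LinearMap.add_apply]; congr 1
      apply BalTensor.hom_ext; intro p q; simp)
    (fun c v n => by
      rw [← LinearMap.smul_apply]; congr 1
      apply BalTensor.hom_ext; intro p q; simp)) (by
    intro a v n
    change H.splitAux N (H.s a * v) n (H.Δ u) = H.splitAux N v (N.act (H.tgt a) n) (H.Δ u)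
    have h1 : H.splitAux N (H.s a * v) n = (H.splitAux N v n).comp (H.rmulL 1 (H.s a)) := by
      apply BalTensor.hom_ext; intro p q; simp [mul_assoc]
    have h2 : H.splitAux N v (N.act (H.tgt a) n) =
        (H.splitAux N v n).comp (H.rmulL (H.tgt a) 1) := by
      apply BalTensor.hom_ext; intro p q; simp [← tmulR_balanced]
    rw [h1, h2, LinearMap.comp_apply, LinearMap.comp_apply, H.Δ_mem u a])

@[simp]
theorem splitMap_tmulFlip (N : LeftMod k U) (u v : U) (n : N.carrier) :
    H.splitMap N u (H.tmulFlip N v n) = H.splitAux N v n (H.Δ u) := rfl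

theorem splitMap_mul_tgt (N : LeftMod k U) (u : U) (a : A) (z : H.TensorFlip N) :
    H.splitMap N (u * H.tgt a) z = H.splitMap N u (H.tgtFlip N a z) := by
  refine BalTensor.apply_ext (g := (H.splitMap N u).comp (H.tgtFlip N a)) (fun v n => ?_) z
  rw [LinearMap.comp_apply, tgtFlip_tmulFlip, splitMap_tmulFlip, splitMap_tmulFlip, Δ_mul_tgt]
  refine BalTensor.apply_ext (f := (H.splitAux N v n).comp (H.rmulL 1 (H.tgt a)))
    (fun p q => ?_) _
  rw [LinearMap.comp_apply, STRing.rmulL_tmulL, splitAux_tmulL, splitAux_tmulL, mul_one,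
    mul_assoc]

theorem splitMap_tgt_mul (N : LeftMod k U) (u : U) (a : A) (z : H.TensorFlip N) :
    H.splitMap N (H.tgt a * u) z = H.tgtFlip (H.tensorMod N) a (H.splitMap N u z) := by
  refine BalTensor.apply_ext
    (g := (H.tgtFlip (H.tensorMod N) a).comp (H.splitMap N u)) (fun v n => ?_) z
  rw [LinearMap.comp_apply, splitMap_tmulFlip, splitMap_tmulFlip, Δ_tgt_mul]
  refine BalTensor.apply_ext (f := (H.splitAux N v n).comp (H.bimodL 1 a))
    (g := (H.tgtFlip (H.tensorMod N) a).comp (H.splitAux N v n)) (fun p q => ?_) _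
  rw [LinearMap.comp_apply, LinearMap.comp_apply, STRing.bimodL_tmulL, splitAux_tmulL,
    splitAux_tmulL, map_one, one_mul, mul_assoc]
  exact (H.tgtFlip_tmulFlip (H.tensorMod N) a (q * v) (H.tmulR N p n)).symm

/-- The bilinear map `(u, z) ↦ splitMap N u z`. -/
def splitBil (N : LeftMod k U) :
    U →ₗ[k] H.TensorFlip N →ₗ[k] H.TensorFlip (H.tensorMod N) where
  toFun := H.splitMap N
  map_add' := fun u u' => BalTensor.hom_ext fun v n => by simp
  map_smul' := fun c u => BalTensor.hom_ext fun v n => by simp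

/-- From `f : n ↦ n₍₁₎ ⊗ n₍₀₎` the map `u ⊗ n ↦ u₍₂₎ n₍₁₎ ⊗ (u₍₁₎ ⊗ n₍₀₎)`. -/
def splitStepMap {N N' : LeftMod k U} (f : H.HomFlip N N') :
    H.TensorR N →ₗ[k] H.TensorFlip (H.tensorMod N') :=
  BalTensor.lift ((H.splitBil N').compl₂ f.1) (fun a u n =>
    (H.splitMap_mul_tgt N' u a (f.1 n)).trans (congrArg (H.splitMap N' u) (f.2 a n).symm))

theorem splitStepMap_tmulR {N N' : LeftMod k U} (f : H.HomFlip N N') (u : U) (n : N.carrier) :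
    H.splitStepMap f (H.tmulR N u n) = H.splitMap N' u (f.1 n) :=
  BalTensor.lift_mk ((H.splitBil N').compl₂ f.1) _ u n

/-- `splitStepMap`, with its compatibility with the left action of `A_R`. -/
def splitStep {N N' : LeftMod k U} (f : H.HomFlip N N') :
    H.HomFlip (H.tensorMod N) (H.tensorMod N') :=
  ⟨H.splitStepMap f, fun a =>
    H.lmulR_hom N (H.splitStepMap f) (H.tgtFlip (H.tensorMod N') a) (H.tgt a) fun u n =>
      (H.splitStepMap_tmulR f (H.tgt a * u) n).trans ((H.splitMap_tgt_mul N' u a (f.1 n)).trans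
        (congrArg (H.tgtFlip (H.tensorMod N') a) (H.splitStepMap_tmulR f u n).symm))⟩

/-- The map `u¹ ⊗ ⋯ ⊗ uᵐ ↦ u¹₍₂₎ ⋯ uᵐ⁻¹₍₂₎ uᵐ ⊗ (u¹₍₁₎ ⊗ ⋯ ⊗ uᵐ⁻¹₍₁₎)`, where `m = n + 2`. -/
def split : ∀ n, H.HomFlip (H.pow (n + 1)) (H.pow n)
  | 0 => H.splitBase
  | n + 1 => H.splitStep (split n)

/-- The map `v ⊗ n ↦ S(v) ⊗ n`. -/
def antipodeTensor (N : LeftMod k U) : H.TensorFlip N →ₗ[k] H.TensorR N :=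
  BalTensor.lift ((H.tmulR N).comp H.S) (by
    intro a v n
    have h := H.tmulR_balanced N a (H.S v) n
    simpa [STRing.lAct, lActR, H.S_mul, H.S_s] using h)

/-- The spaces `C_n(U)`: `C_0(U) = A_R` and `C_n(U) = U ⊗_{A_R} ⋯ ⊗_{A_R} U` (`n` factors). -/
def Chain : ℕ → Type u
  | 0 => A
  | n + 1 => (H.pow n).carrier

instance : ∀ n, AddCommGroup (H.Chain n)
  | 0 => inferInstanceAs (AddCommGroup A)
  | n + 1 => inferInstanceAs (AddCommGroup (H.pow n).carrier)

instance : ∀ n, Module k (H.Chain n)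
  | 0 => inferInstanceAs (Module k A)
  | n + 1 => inferInstanceAs (Module k (H.pow n).carrier)

/-- The faces `d_i : C_{n + 1}(U) → C_n(U)`, `0 ≤ i ≤ n + 1`. On `C_1(U) = U` they are
`d_0 = ε_R` and `d_1 = ε_R ∘ S`. -/
def face : ∀ n, Fin (n + 2) → H.Chain (n + 1) →ₗ[k] H.Chain n
  | 0, i => Fin.cases (motive := fun _ => U →ₗ[k] A) H.εR (fun _ => H.εR.comp H.S) i
  | n + 1, i => Fin.cases (motive := fun _ => (H.pow (n + 1)).carrier →ₗ[k] (H.pow n).carrier)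
      (H.faceZero (H.pow n)) (fun j => (H.facePos n j).1) i

/-- The degeneracies `s_i : C_n(U) → C_{n + 1}(U)`, `0 ≤ i ≤ n`. On `C_0(U) = A_R` it is
`s_0 = s_R : A_R → U`. -/
def degen : ∀ n, Fin (n + 1) → H.Chain n →ₗ[k] H.Chain (n + 1)
  | 0, _ => H.sR
  | n + 1, i => (H.degenPow n i).1

/-- The cyclic operators `t_n : C_n(U) → C_n(U)`,
`t_n (u¹ ⊗ ⋯ ⊗ uⁿ) = S(u¹₍₂₎ ⋯ uⁿ⁻¹₍₂₎ uⁿ) ⊗ u¹₍₁₎ ⊗ ⋯ ⊗ uⁿ⁻¹₍₁₎`. In particular `t_1 = S`,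
and `t_0 = id`. -/
def cyc : ∀ n, H.Chain n →ₗ[k] H.Chain n
  | 0 => LinearMap.id
  | 1 => H.S
  | n + 2 => (H.antipodeTensor (H.pow n)).comp (H.split n).1

/-- The cyclic module `C_•(U)`, by its spaces and operators. -/
def cyclic : CyclicOperators.{u} k where
  X := H.Chain
  d := H.face
  s := H.degen
  t := H.cyc

end HopfAlgebroid

namespace Measuring

variable {k : Type*} [Field k] {A U : Type u} [Ring A] [Algebra k A] [Ring U] [Algebra k U]
  {A' U' : Type v} [Ring A'] [Algebra k A'] [Ring U'] [Algebra k U']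
  {H : HopfAlgebroid k A U} {H' : HopfAlgebroid k A' U'}
  {C : Type*} [AddCommGroup C] [Module k C] [Coalgebra k C]

/-- The element `x₍₁₎(u⁰) ⊗ x₍₂₎(u¹) ⊗ ⋯ ⊗ x₍ₙ₊₁₎(uⁿ)` of `C_{n + 1}(U')`, as a linear function
of `x`. Here `x₍₁₎ ⊗ ⋯ ⊗ x₍ₙ₊₁₎` is the iterated coproduct, taken as
`x₍₁₎ ⊗ (x₍₂₎)₍₁₎ ⊗ ⋯ ⊗ (x₍₂₎)₍ₙ₎`. -/
def tensorAct (m : Measuring H H' C) : ∀ n, (Fin (n + 1) → U) → C →ₗ[k] H'.Chain (n + 1)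
  | 0, u => m.Ψ.flip (u 0)
  | n + 1, u =>
    (TensorProduct.lift (H'.cons n)).comp
      ((TensorProduct.map (m.Ψ.flip (u 0)) (tensorAct m n (Fin.tail u))).comp
        (Coalgebra.comul (R := k) (A := C)))

end Measuring

end HopfMeas

end

noncomputable section

namespace HopfMeas

/-! ## Convolution along a bilinear map -/

section Conv

variable {k : Type*} [Field k] {C : Type*} [AddCommGroup C] [Module k C] [Coalgebra k C]
  {M N P Q R S : Type*}
  [AddCommGroup M] [Module k M] [AddCommGroup N] [Module k N] [AddCommGroup P] [Module k P]
  [AddCommGroup Q] [Module k Q] [AddCommGroup R] [Module k R] [AddCommGroup S] [Module k S]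

/-! Sweedler sums over `C` disappear if `x` is kept as a variable: each chain `z` is sent to the
whole linear map `x ↦ x(z)` from `C` to the chains of `U'`. On a pure tensor this map is a
convolution, along the tensor product, of the maps of the factors. Every claim then becomes an
identity between convolutions. These follow from naturality in the bilinear map (`comp_conv_eq`),
coassociativity (`conv_assoc`), the counit (`unit_conv`, `conv_unit`) and cocommutativity
(`conv_comm`).

In `U ⊗_{A_R} N` the scalar sits between the two factors, so well-definedness is pure associativity,
as is compatibility with the multiplication faces. The other faces need only naturality and the
intertwining of `s_R`, `ε` and `S`; the degeneracies insert `1`, and `x(1) = ε(x) 1` is absorbed by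
the counit. An induction on the number of factors, carried by `ModMeasuring`, treats all of them.

The cyclic operator permutes factors, and it is here that cocommutativity is needed. It is `S` on
one factor composed with the splitting `u¹ ⊗ ⋯ ⊗ uᵐ ↦ u¹₍₂₎ ⋯ uᵐ ⊗ (u¹₍₁₎ ⊗ ⋯)`. The measuring acts
on `U ⊗_{A_L} U` and is comultiplicative there (`tensorLHat_Δ`); moving `u₍₁₎` past the other
factors is allowed because the copies of `x` can be exchanged (`flipHat_splitAux`). -/

/-- The convolution `x ↦ B(f(x₍₁₎), g(x₍₂₎))` of `f` and `g` along the bilinear map `B`. -/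
def conv (B : M →ₗ[k] N →ₗ[k] P) : (C →ₗ[k] M) →ₗ[k] (C →ₗ[k] N) →ₗ[k] C →ₗ[k] P :=
  LinearMap.mk₂ k
    (fun f g => (TensorProduct.lift B).comp
      ((TensorProduct.map f g).comp (Coalgebra.comul (R := k) (A := C))))
    (fun f f' g => by
      rw [TensorProduct.map_add_left, LinearMap.add_comp, LinearMap.comp_add])
    (fun c f g => by
      rw [TensorProduct.map_smul_left, LinearMap.smul_comp, LinearMap.comp_smul])
    (fun f g g' => by
      rw [TensorProduct.map_add_right, LinearMap.add_comp, LinearMap.comp_add])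
    (fun c f g => by
      rw [TensorProduct.map_smul_right, LinearMap.smul_comp, LinearMap.comp_smul])

theorem conv_apply (B : M →ₗ[k] N →ₗ[k] P) (f : C →ₗ[k] M) (g : C →ₗ[k] N) (x : C) :
    conv B f g x =
      TensorProduct.lift B (TensorProduct.map f g (Coalgebra.comul (R := k) x)) := rfl

theorem lift_map (B : M →ₗ[k] N →ₗ[k] P) (f : Q →ₗ[k] M) (g : R →ₗ[k] N) (z : Q ⊗[k] R) :
    TensorProduct.lift B (TensorProduct.map f g z) = TensorProduct.lift (B.compl₁₂ f g) z := by
  refine LinearMap.congr_fun (f := (TensorProduct.lift B).comp (TensorProduct.map f g)) ?_ z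
  ext; rfl

theorem conv_apply' (B : M →ₗ[k] N →ₗ[k] P) (f : C →ₗ[k] M) (g : C →ₗ[k] N) (x : C) :
    conv B f g x = TensorProduct.lift (B.compl₁₂ f g) (Coalgebra.comul (R := k) x) := by
  rw [conv_apply, lift_map]

/-- Naturality of the convolution in all three variables. -/
theorem comp_conv_eq {M' N' P' : Type*} [AddCommGroup M'] [Module k M'] [AddCommGroup N']
    [Module k N'] [AddCommGroup P'] [Module k P'] (B : M →ₗ[k] N →ₗ[k] P)
    (B' : M' →ₗ[k] N' →ₗ[k] P') (e : P →ₗ[k] P') (p : M →ₗ[k] M') (q : N →ₗ[k] N')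
    (h : ∀ a b, e (B a b) = B' (p a) (q b)) (f : C →ₗ[k] M) (g : C →ₗ[k] N) :
    e.comp (conv B f g) = conv B' (p.comp f) (q.comp g) := by
  ext x
  rw [LinearMap.comp_apply, conv_apply', conv_apply']
  refine LinearMap.congr_fun (f := e.comp (TensorProduct.lift (B.compl₁₂ f g))) ?_ _
  ext a b
  exact h _ _

theorem comp_conv (B : M →ₗ[k] N →ₗ[k] P) (B' : M →ₗ[k] N →ₗ[k] Q) (e : P →ₗ[k] Q)
    (h : ∀ a b, e (B a b) = B' a b) (f : C →ₗ[k] M) (g : C →ₗ[k] N) :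
    e.comp (conv B f g) = conv B' f g := by
  simpa using comp_conv_eq B B' e LinearMap.id LinearMap.id h f g

theorem comp_conv_left (B : M →ₗ[k] N →ₗ[k] P) (B' : R →ₗ[k] N →ₗ[k] Q) (e : P →ₗ[k] Q)
    (p : M →ₗ[k] R) (h : ∀ a b, e (B a b) = B' (p a) b) (f : C →ₗ[k] M) (g : C →ₗ[k] N) :
    e.comp (conv B f g) = conv B' (p.comp f) g := by
  simpa using comp_conv_eq B B' e p LinearMap.id h f g

theorem comp_conv_right (B : M →ₗ[k] N →ₗ[k] P) (B' : M →ₗ[k] R →ₗ[k] Q) (e : P →ₗ[k] Q)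
    (q : N →ₗ[k] R) (h : ∀ a b, e (B a b) = B' a (q b)) (f : C →ₗ[k] M) (g : C →ₗ[k] N) :
    e.comp (conv B f g) = conv B' f (q.comp g) := by
  simpa using comp_conv_eq B B' e LinearMap.id q h f g

theorem conv_comp_left (B : M →ₗ[k] N →ₗ[k] P) (p : R →ₗ[k] M) (f : C →ₗ[k] R) (g : C →ₗ[k] N) :
    conv B (p.comp f) g = conv (B.comp p) f g := by
  simpa using (comp_conv_left (B.comp p) B LinearMap.id p (fun _ _ => rfl) f g).symm

theorem conv_comp_right (B : M →ₗ[k] N →ₗ[k] P) (q : R →ₗ[k] N) (f : C →ₗ[k] M) (g : C →ₗ[k] R) :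
    conv B f (q.comp g) = conv (B.compl₂ q) f g := by
  simpa using (comp_conv_right (B.compl₂ q) B LinearMap.id q (fun _ _ => rfl) f g).symm

/-- Associativity of convolutions. -/
theorem conv_assoc (B₁ : P →ₗ[k] Q →ₗ[k] S) (B₂ : M →ₗ[k] N →ₗ[k] P) (B₃ : M →ₗ[k] R →ₗ[k] S)
    (B₄ : N →ₗ[k] Q →ₗ[k] R) (h : ∀ a b c, B₁ (B₂ a b) c = B₃ a (B₄ b c))
    (f : C →ₗ[k] M) (g : C →ₗ[k] N) (e : C →ₗ[k] Q) :
    conv B₁ (conv B₂ f g) e = conv B₃ f (conv B₄ g e) := by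
  ext x
  have hc := Coalgebra.coassoc_apply (R := k) x
  -- Both iterated convolutions are one linear map on `C ⊗ (C ⊗ C)`, evaluated at the two sides of
  -- the coassociativity identity `hc`.
  have h1 : ∀ z : C ⊗[k] C,
      TensorProduct.lift (B₁.compl₁₂ (conv B₂ f g) e) z =
        TensorProduct.lift (B₃.compl₁₂ f (TensorProduct.lift (B₄.compl₁₂ g e)))
          (TensorProduct.assoc k C C C (Coalgebra.comul.rTensor C z)) := by
    intro z
    induction z with
    | zero => simp
    | add a b ha hb => simp only [map_add, ha, hb]
    | tmul a b =>
      rw [TensorProduct.lift.tmul, LinearMap.rTensor_tmul, LinearMap.compl₁₂_apply, conv_apply']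
      induction Coalgebra.comul (R := k) a with
      | zero => simp
      | add c d hc hd => simp only [map_add, LinearMap.add_apply, hc, hd, TensorProduct.add_tmul]
      | tmul c d => simp [h]
  have h2 : ∀ z : C ⊗[k] C,
      TensorProduct.lift (B₃.compl₁₂ f (conv B₄ g e)) z =
        TensorProduct.lift (B₃.compl₁₂ f (TensorProduct.lift (B₄.compl₁₂ g e)))
          (Coalgebra.comul.lTensor C z) := by
    intro z
    induction z with
    | zero => simp
    | add a b ha hb => simp only [map_add, ha, hb]
    | tmul a b =>
      rw [TensorProduct.lift.tmul, LinearMap.lTensor_tmul, LinearMap.compl₁₂_apply, conv_apply']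
      rfl
  rw [conv_apply', conv_apply', h1, h2, hc]

/-- Cocommutativity enters the whole argument through this exchange of factors alone. -/
theorem conv_comm [Coalgebra.IsCocomm k C] (B : M →ₗ[k] N →ₗ[k] P) (f : C →ₗ[k] M)
    (g : C →ₗ[k] N) : conv B f g = conv B.flip g f := by
  ext x
  rw [conv_apply', conv_apply']
  have h : ∀ z : C ⊗[k] C, TensorProduct.lift (B.compl₁₂ f g) z =
      TensorProduct.lift (B.flip.compl₁₂ g f) (TensorProduct.comm k C C z) := by
    intro z
    induction z with
    | zero => simp
    | add a b ha hb => simp only [map_add, ha, hb]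
    | tmul a b => rfl
  rw [h, Coalgebra.comm_comul]

/-- Left commutativity of convolutions over a cocommutative coalgebra. -/
theorem conv_left_comm [Coalgebra.IsCocomm k C] (B₁ : P →ₗ[k] Q →ₗ[k] S)
    (B₂ : M →ₗ[k] N →ₗ[k] P) (B₃ : N →ₗ[k] R →ₗ[k] S) (B₄ : M →ₗ[k] Q →ₗ[k] R)
    (h : ∀ a b c, B₁ (B₂ a b) c = B₃ b (B₄ a c))
    (f : C →ₗ[k] M) (g : C →ₗ[k] N) (e : C →ₗ[k] Q) :
    conv B₁ (conv B₂ f g) e = conv B₃ g (conv B₄ f e) := by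
  rw [conv_comm B₂]
  exact conv_assoc B₁ B₂.flip B₃ B₄ (fun b a c => h a b c) g f e

/-- The map `x ↦ ε(x) m`. -/
def unitMap (k : Type*) [Field k] (C : Type*) [AddCommGroup C] [Module k C] [Coalgebra k C]
    {M : Type*} [AddCommGroup M] [Module k M] (m : M) : C →ₗ[k] M :=
  (Coalgebra.counit (R := k) (A := C)).smulRight m

/-- By the counit axiom the factor `ε(x₍₁₎)` is absorbed into `x₍₂₎`. With `x(1) = ε(x) 1` this
handles an inserted unit. -/
theorem unit_conv (B : M →ₗ[k] N →ₗ[k] P) (m : M) (g : C →ₗ[k] N) :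
    conv B (unitMap k C m) g = (B m).comp g := by
  ext x
  have h : ∀ z : C ⊗[k] C, TensorProduct.lift (B.compl₁₂ (unitMap k C m) g) z =
      TensorProduct.lift ((LinearMap.lsmul k P).compl₂ ((B m).comp g))
        (Coalgebra.counit.rTensor C z) := by
    intro z
    induction z with
    | zero => simp
    | add a b ha hb => simp only [map_add, ha, hb]
    | tmul a b => simp [unitMap]
  rw [conv_apply', h, Coalgebra.rTensor_counit_comul]
  simp

theorem conv_unit (B : M →ₗ[k] N →ₗ[k] P) (n : N) (f : C →ₗ[k] M) :
    conv B f (unitMap k C n) = (B.flip n).comp f := by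
  ext x
  have h : ∀ z : C ⊗[k] C, TensorProduct.lift (B.compl₁₂ f (unitMap k C n)) z =
      TensorProduct.lift ((LinearMap.lsmul k P).flip.comp ((B.flip n).comp f))
        (Coalgebra.counit.lTensor C z) := by
    intro z
    induction z with
    | zero => simp
    | add a b ha hb => simp only [map_add, ha, hb]
    | tmul a b => simp [unitMap]
  rw [conv_apply', h, Coalgebra.lTensor_counit_comul]
  simp

-- From here on convolutions are manipulated only through the lemmas above, and definitional
-- unfolding stops at them.
attribute [irreducible] conv

end Conv

/-! ## Maps induced on homology -/

/-- A map commuting with the differentials preserves cycles and boundaries. The quotient is by the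
boundaries lying among the cycles, so `d ∘ d = 0` need not be known. -/
theorem inducesOnHomology_of_comm {k : Type*} [Field k] {X Y : ℕ → Type*}
    [∀ n, AddCommGroup (X n)] [∀ n, Module k (X n)] [∀ n, AddCommGroup (Y n)]
    [∀ n, Module k (Y n)] (d : ∀ n, X (n + 1) →ₗ[k] X n) (d' : ∀ n, Y (n + 1) →ₗ[k] Y n)
    (φ : ∀ n, X n →ₗ[k] Y n) (h : ∀ n z, φ n (d n z) = d' n (φ (n + 1) z)) (n : ℕ) :
    InducesOnHomology d d' φ n := by
  have hc : ∀ n, ∀ z ∈ cycles d n, φ n z ∈ cycles d' n := by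
    rintro (_ | n) z hz
    · exact Submodule.mem_top
    · change d' n (φ (n + 1) z) = 0
      rw [← h, show d n z = 0 from hz, map_zero]
  refine ⟨Submodule.mapQ _ _ ((φ n).restrict (hc n)) ?_, fun z => ⟨hc n z z.2, rfl⟩⟩
  rintro ⟨z, hz⟩ ⟨y, hy⟩
  refine ⟨φ (n + 1) y, ?_⟩
  rw [← h, hy]
  rfl

/-! ### Morphisms of cyclic modules and the cyclic bicomplex -/

namespace CyclicOperators

variable {k : Type*} [Field k] {Z : CyclicOperators.{v} k} {Z' : CyclicOperators.{w} k}
  {φ : ∀ n, Z.X n →ₗ[k] Z'.X n}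

namespace IsMorphism

theorem map_b (h : IsMorphism φ) (n : ℕ) (z : Z.X (n + 1)) :
    φ n (Z.b n z) = Z'.b n (φ (n + 1) z) := by
  simp [b, LinearMap.sum_apply, h.map_d]

theorem map_b' (h : IsMorphism φ) (n : ℕ) (z : Z.X (n + 1)) :
    φ n (Z.b' n z) = Z'.b' n (φ (n + 1) z) := by
  simp [b', LinearMap.sum_apply, h.map_d]

theorem map_sgnT (h : IsMorphism φ) (n : ℕ) (z : Z.X n) :
    φ n (Z.sgnT n z) = Z'.sgnT n (φ n z) := by
  simp [sgnT, h.map_t]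

theorem map_sgnT_pow (h : IsMorphism φ) (n i : ℕ) (z : Z.X n) :
    φ n ((Z.sgnT n ^ i) z) = (Z'.sgnT n ^ i) (φ n z) := by
  induction i with
  | zero => rfl
  | succ i ih => rw [pow_succ', pow_succ', Module.End.mul_apply, Module.End.mul_apply,
      h.map_sgnT, ih]

theorem map_norm (h : IsMorphism φ) (n : ℕ) (z : Z.X n) :
    φ n (Z.norm n z) = Z'.norm n (φ n z) := by
  simp [norm, LinearMap.sum_apply, h.map_sgnT_pow]

theorem map_totD (h : IsMorphism φ) (n : ℕ) (z : Z.Tot (n + 1)) :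
    totMap φ n (Z.totD n z) = Z'.totD n (totMap φ (n + 1) z) := by
  funext q
  change φ q (Z.totD n z q) = Z'.totD n (totMap φ (n + 1) z) q
  unfold totD
  rw [LinearMap.pi_apply, LinearMap.pi_apply]
  split_ifs
  -- The components of `z` live in degrees `q.succ` and `q.castSucc`, which are `q + 1` and `q` only
  -- by definitional unfolding; stating the identity for free elements avoids rewriting in those
  -- types.
  · have key : ∀ (a : Z.X (q + 1)) (c : Z.X q), φ q (Z.b q a + (c - Z.sgnT q c)) =
        Z'.b q (φ (q + 1) a) + (φ q c - Z'.sgnT q (φ q c)) := fun a c => by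
      rw [map_add, map_sub, h.map_b, h.map_sgnT]
    exact key _ _
  · have key : ∀ (a : Z.X (q + 1)) (c : Z.X q), φ q (-Z.b' q a + Z.norm q c) =
        -Z'.b' q (φ (q + 1) a) + Z'.norm q (φ q c) := fun a c => by
      rw [map_add, map_neg, h.map_b', h.map_norm]
    exact key _ _

end IsMorphism

end CyclicOperators

/-! ### Measured modules and tensor products over the base `A_R` -/

namespace Measuring

variable {k : Type*} [Field k] {A U : Type u} [Ring A] [Algebra k A] [Ring U] [Algebra k U]
  {A' U' : Type v} [Ring A'] [Algebra k A'] [Ring U'] [Algebra k U']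
  {H : HopfAlgebroid k A U} {H' : HopfAlgebroid k A' U'}
  {C : Type*} [AddCommGroup C] [Module k C] [Coalgebra k C]
  (m : Measuring H H' C)

/-- The axioms of a measuring are recast, here and in the next lemmas, as identities between linear
maps out of `C`: `m.Ψ.flip a` is `x ↦ x(a)`. -/
theorem Ψ_flip_mul (a b : U) :
    m.Ψ.flip (a * b) = conv (LinearMap.mul k U') (m.Ψ.flip a) (m.Ψ.flip b) :=
  LinearMap.ext fun x => (m.measΨ.map_mul x a b).trans (conv_apply _ _ _ x).symm

theorem Ψ_flip_one : m.Ψ.flip 1 = unitMap k C (1 : U') :=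
  LinearMap.ext fun x => m.measΨ.map_one x

theorem Ψ_flip_s (a : A) : m.Ψ.flip (H.s a) = H'.s.toLinearMap.comp (m.ψ.flip a) :=
  LinearMap.ext fun x => m.map_s x a

theorem Ψ_flip_tgt (a : A) : m.Ψ.flip (H.tgt a) = H'.sR.comp (m.ψ.flip a) :=
  LinearMap.ext fun x => m.map_t x a

theorem Ψ_flip_S (u : U) : m.Ψ.flip (H.S u) = H'.S.comp (m.Ψ.flip u) :=
  LinearMap.ext fun x => m.map_S x u

theorem ψ_flip_ε (u : U) : m.ψ.flip (H.ε u) = H'.ε.comp (m.Ψ.flip u) :=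
  LinearMap.ext fun x => m.map_ε x u

theorem ψ_flip_εR (u : U) : m.ψ.flip (H.εR u) = H'.εR.comp (m.Ψ.flip u) := by
  change m.ψ.flip (H.ε (H.S u)) = _
  rw [ψ_flip_ε, Ψ_flip_S]
  rfl

/-- A measuring of left modules over the measuring `m` of algebras: a linear map
`n ↦ (x ↦ x(n))` with `x(u n) = x₍₁₎(u) x₍₂₎(n)`. -/
structure ModMeasuring (N : LeftMod k U) (N' : LeftMod k U') where
  /-- the map `n ↦ (x ↦ x(n))` -/
  hat : N.carrier →ₗ[k] C →ₗ[k] N'.carrier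
  hat_act : ∀ u n, hat (N.act u n) = conv N'.act.toLinearMap (m.Ψ.flip u) (hat n)

open HopfAlgebroid (baseMod)

namespace ModMeasuring

variable {m} {N : LeftMod k U} {N' : LeftMod k U'} (h : m.ModMeasuring N N')

/-- Since `x ∘ t = t' ∘ x`, the scalar contributes a convolution factor with values in the base
`A'`, the form that can be moved across a balanced tensor product. -/
theorem hat_tgt (a : A) (n : N.carrier) : h.hat (N.act (H.tgt a) n) =
    conv (N'.act.toLinearMap.comp H'.sR) (m.ψ.flip a) (h.hat n) := by
  rw [h.hat_act, Ψ_flip_tgt, conv_comp_left]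

/-- The total algebra as a measured module. -/
def base (m : Measuring H H' C) : m.ModMeasuring (baseMod k U) (baseMod k U') :=
  ⟨m.Ψ.flip, m.Ψ_flip_mul⟩

/-- `x(u ⊗ n) = x₍₁₎(u) ⊗ x₍₂₎(n)` on `U ⊗_{A_R} N`. -/
def tensorHat : H.TensorR N →ₗ[k] C →ₗ[k] H'.TensorR N' :=
  BalTensor.lift ((conv (H'.tmulR N')).compl₁₂ m.Ψ.flip h.hat) (by
    intro a p n
    change conv (H'.tmulR N') (m.Ψ.flip (p * H.tgt a)) (h.hat n) =
      conv (H'.tmulR N') (m.Ψ.flip p) (h.hat (N.act (H.tgt a) n))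
    have hp : m.Ψ.flip (p * H.tgt a) =
        conv ((LinearMap.mul k U').compl₂ H'.sR) (m.Ψ.flip p) (m.ψ.flip a) := by
      rw [Ψ_flip_mul, Ψ_flip_tgt, conv_comp_right]
    rw [hp, h.hat_tgt]
    -- The factors `p`, `a`, `n` occur in the same order on both sides, only bracketed differently,
    -- so no commutation is needed.
    exact conv_assoc (H'.tmulR N') ((LinearMap.mul k U').compl₂ H'.sR) (H'.tmulR N')
      (N'.act.toLinearMap.comp H'.sR) (fun p a n => H'.tmulR_balanced N' a p n) _ _ _)

theorem tensorHat_tmulR (p : U) (n : N.carrier) :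
    h.tensorHat (H.tmulR N p n) = conv (H'.tmulR N') (m.Ψ.flip p) (h.hat n) := rfl

/-- `U ⊗_{A_R} N` as a measured module. -/
def tensor : m.ModMeasuring (H.tensorMod N) (H'.tensorMod N') :=
  ⟨h.tensorHat, fun u z => by
    refine BalTensor.apply_ext (f := h.tensorHat.comp (H.lmulR N u))
      (g := (conv (H'.tensorMod N').act.toLinearMap (m.Ψ.flip u)).comp h.tensorHat)
      (fun p n => ?_) z
    rw [LinearMap.comp_apply, LinearMap.comp_apply, HopfAlgebroid.lmulR_tmulR, tensorHat_tmulR,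
      tensorHat_tmulR, Ψ_flip_mul]
    exact conv_assoc (H'.tmulR N') (LinearMap.mul k U') (H'.tensorMod N').act.toLinearMap
      (H'.tmulR N') (fun u p n => (H'.lmulR_tmulR N' u p n).symm) _ _ _⟩

/-- The measuring of `U ⊗_{A_R} ⋯ ⊗_{A_R} U`. -/
def pow (m : Measuring H H' C) : ∀ n, m.ModMeasuring (H.pow n) (H'.pow n)
  | 0 => base m
  | n + 1 => (pow m n).tensor

/-- Both sides recurse by splitting off the first factor, with the iterated coproduct nested to the
right. -/
theorem pow_hat_tprod (m : Measuring H H' C) : ∀ (n : ℕ) (u : Fin (n + 1) → U),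
    (pow m n).hat (H.tprod n u) = m.tensorAct n u
  | 0, _ => rfl
  | n + 1, u => by
    change conv (H'.tmulR (H'.pow n)) (m.Ψ.flip (u 0)) ((pow m n).hat (H.tprod n (Fin.tail u))) = _
    rw [pow_hat_tprod m n (Fin.tail u)]
    exact LinearMap.ext fun x => conv_apply _ _ _ x

/-! ### Compatibility with faces and degeneracies -/

theorem hat_faceZero (z : H.TensorR N) :
    h.hat (H.faceZero N z) = (H'.faceZero N').comp (h.tensor.hat z) := by
  refine BalTensor.apply_ext (f := h.hat.comp (H.faceZero N))
    -- Postcomposition with the face is written as a linear map, so that both sides are linear in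
    -- `z` and can be compared on pure tensors. The same device recurs below.
    (g := (LinearMap.llcomp k C _ _ (H'.faceZero N')).comp h.tensorHat) (fun p n => ?_) z
  change h.hat (N.act (H.tgt (H.εR p)) n) =
    (H'.faceZero N').comp (conv (H'.tmulR N') (m.Ψ.flip p) (h.hat n))
  rw [h.hat_tgt, ψ_flip_εR]
  exact (comp_conv_left _ _ _ H'.εR (fun _ _ => rfl) _ _).symm

theorem hat_faceOne (z : H.TensorR N) :
    h.hat ((H.faceOne N).1 z) = (H'.faceOne N').1.comp (h.tensor.hat z) := by
  refine BalTensor.apply_ext (f := h.hat.comp (H.faceOne N).1)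
    (g := (LinearMap.llcomp k C _ _ (H'.faceOne N').1).comp h.tensorHat) (fun p n => ?_) z
  change h.hat (N.act p n) =
    (H'.faceOne N').1.comp (conv (H'.tmulR N') (m.Ψ.flip p) (h.hat n))
  rw [h.hat_act]
  exact (comp_conv _ _ _ (fun _ _ => rfl) _ _).symm

theorem hat_faceLast (z : H.TensorR (baseMod k U)) :
    (base m).hat (H.faceLast.1 z) = H'.faceLast.1.comp ((base m).tensor.hat z) := by
  refine BalTensor.apply_ext (f := (base m).hat.comp H.faceLast.1)
    (g := (LinearMap.llcomp k C _ _ H'.faceLast.1).comp (base m).tensorHat) (fun p n => ?_) z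
  change m.Ψ.flip (p * H.tgt (H.εR (H.S n))) = H'.faceLast.1.comp
    (conv (H'.tmulR (baseMod k U')) (m.Ψ.flip p) (m.Ψ.flip n))
  rw [Ψ_flip_mul, Ψ_flip_tgt, ψ_flip_εR, Ψ_flip_S]
  exact (comp_conv_right _ _ _ (H'.sR.comp (H'.εR.comp H'.S)) (fun _ _ => rfl) _ _).symm

/-- This is the inductive step for the inner faces and degeneracies: naturality of the convolution
in its second factor carries compatibility from `f` to `id ⊗ f`. -/
theorem hat_idTensor {P : LeftMod k U} {P' : LeftMod k U'} (h' : m.ModMeasuring P P')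
    (f : H.HomR N P) (f' : H'.HomR N' P') (hf : ∀ n, h'.hat (f.1 n) = f'.1.comp (h.hat n))
    (z : H.TensorR N) :
    h'.tensor.hat ((H.idTensor f).1 z) = (H'.idTensor f').1.comp (h.tensor.hat z) := by
  refine BalTensor.apply_ext (f := h'.tensorHat.comp (H.idTensor f).1)
    (g := (LinearMap.llcomp k C _ _ (H'.idTensor f').1).comp h.tensorHat) (fun p n => ?_) z
  change conv (H'.tmulR P') (m.Ψ.flip p) (h'.hat (f.1 n)) = (H'.idTensor f').1.comp
    (conv (H'.tmulR N') (m.Ψ.flip p) (h.hat n))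
  rw [hf]
  exact (comp_conv_right _ _ _ f'.1 (fun _ _ => rfl) _ _).symm

theorem hat_degenZero (n : N.carrier) :
    h.tensor.hat ((H.degenZero N).1 n) = (H'.degenZero N').1.comp (h.hat n) := by
  change conv (H'.tmulR N') (m.Ψ.flip 1) (h.hat n) = _
  rw [Ψ_flip_one, unit_conv]
  rfl

theorem hat_degenLast (u : U) :
    (base m).tensor.hat (H.degenLast.1 u) = H'.degenLast.1.comp ((base m).hat u) := by
  change conv (H'.tmulR (baseMod k U')) (m.Ψ.flip u) (m.Ψ.flip 1) = _
  rw [Ψ_flip_one, conv_unit]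
  rfl

theorem hat_facePos (m : Measuring H H' C) : ∀ (n j : ℕ) (z : (H.pow (n + 1)).carrier),
    (pow m n).hat ((H.facePos n j).1 z) = (H'.facePos n j).1.comp ((pow m (n + 1)).hat z)
  | 0, 0 => (base m).hat_faceOne
  | n + 1, 0 => (pow m (n + 1)).hat_faceOne
  | 0, _ + 1 => hat_faceLast
  | n + 1, j + 1 => (pow m (n + 1)).hat_idTensor (pow m n) _ _ (hat_facePos m n j)

theorem hat_degenPow (m : Measuring H H' C) : ∀ (n j : ℕ) (z : (H.pow n).carrier),
    (pow m (n + 1)).hat ((H.degenPow n j).1 z) = (H'.degenPow n j).1.comp ((pow m n).hat z)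
  | 0, 0 => (base m).hat_degenZero
  | n + 1, 0 => (pow m (n + 1)).hat_degenZero
  | 0, _ + 1 => fun u : U => hat_degenLast u
  | n + 1, j + 1 => (pow m n).hat_idTensor (pow m (n + 1)) _ _ (hat_degenPow m n j)

end ModMeasuring

/-! ### The induced maps of chains -/

/-- The map `n ↦ (x ↦ x(n))` on `C_n(U)`. -/
def chainHat : ∀ n, H.Chain n →ₗ[k] C →ₗ[k] H'.Chain n
  | 0 => m.ψ.flip
  | n + 1 => (ModMeasuring.pow m n).hat

theorem chainHat_face : ∀ (n : ℕ) (i : Fin (n + 2)) (z : H.Chain (n + 1)),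
    m.chainHat n (H.face n i z) = (H'.face n i).comp (m.chainHat (n + 1) z)
  | 0, i, z => by
    refine Fin.cases ?_ (fun j => ?_) i
    · exact m.ψ_flip_εR z
    · exact (m.ψ_flip_εR (H.S z)).trans (congrArg H'.εR.comp (m.Ψ_flip_S z))
  | n + 1, i, z => by
    refine Fin.cases ?_ (fun j => ?_) i
    · exact (ModMeasuring.pow m n).hat_faceZero z
    · exact ModMeasuring.hat_facePos m n j z

theorem chainHat_degen : ∀ (n : ℕ) (i : Fin (n + 1)) (z : H.Chain n),
    m.chainHat (n + 1) (H.degen n i z) = (H'.degen n i).comp (m.chainHat n z)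
  | 0, _, z => m.Ψ_flip_tgt z
  | n + 1, i, z => ModMeasuring.hat_degenPow m n i z

end Measuring

/-! ### Bilinear forms of the splitting maps -/

namespace HopfAlgebroid

variable {k : Type*} [Field k] {A U : Type u} [Ring A] [Algebra k A] [Ring U] [Algebra k U]
  (H : HopfAlgebroid k A U)

/-- The bilinear map `(p ⊗ q, v) ↦ q v ⊗ p`. -/
def splitAuxBil₀ : H.TensorL →ₗ[k] U →ₗ[k] H.TensorFlip (baseMod k U) :=
  LinearMap.flip
    { toFun := H.splitAux₀
      map_add' := fun v v' => BalTensor.hom_ext fun p q => by simp [mul_add]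
      map_smul' := fun c v => BalTensor.hom_ext fun p q => by simp }

/-- The bilinear map `(p ⊗ q, v ⊗ n) ↦ q v ⊗ (p ⊗ n)`. -/
def splitAuxBil (N : LeftMod k U) :
    H.TensorL →ₗ[k] U ⊗[k] N.carrier →ₗ[k] H.TensorFlip (H.tensorMod N) :=
  (TensorProduct.lift (LinearMap.mk₂ k (H.splitAux N)
    (fun v v' n => BalTensor.hom_ext fun p q => by simp [mul_add])
    (fun c v n => BalTensor.hom_ext fun p q => by simp)
    (fun v n n' => BalTensor.hom_ext fun p q => by simp)
    (fun c v n => BalTensor.hom_ext fun p q => by simp))).flip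

/-- The bilinear map `(p, v ⊗ n) ↦ v ⊗ (p ⊗ n)`. -/
def insertBil (N : LeftMod k U) :
    U →ₗ[k] U ⊗[k] N.carrier →ₗ[k] H.TensorFlip (H.tensorMod N) where
  toFun p := TensorProduct.lift ((H.tmulFlip (H.tensorMod N)).compl₂ (H.tmulR N p))
  map_add' p p' := by ext v n; simp
  map_smul' c p := by ext v n; simp

/-- Multiplication by `q` and insertion of `p` become separate operations, which is the shape of the
hypothesis of `conv_assoc`. -/
theorem splitAuxBil_tmulL (N : LeftMod k U) (p q : U) (w : U ⊗[k] N.carrier) :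
    H.splitAuxBil N (H.tmulL p q) w =
      H.insertBil N p (LinearMap.rTensorHom N.carrier (LinearMap.mul k U q) w) := by
  induction w with
  | zero => simp
  | add a b ha hb => simp only [map_add, ha, hb]
  | tmul v n => rfl

/-- `splitAuxBil` takes arbitrary elements of `U ⊗_{A_L} U`, so its second argument must stay in `U
⊗_k N`; it descends to `TensorFlip N` only for elements of the Takeuchi product such as `Δ(u)`. This
identity links the two levels. -/
theorem splitBil_compl₂_mkQ (N : LeftMod k U) :
    (H.splitBil N).compl₂ (balRel H.lAct (H.lActR N)).mkQ = (H.splitAuxBil N).comp H.Δ := by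
  ext u v n
  rfl

end HopfAlgebroid

/-! ### Cocommutative measurings, the coproduct and the cyclic operators -/

namespace Measuring

variable {k : Type*} [Field k] {A U : Type u} [Ring A] [Algebra k A] [Ring U] [Algebra k U]
  {A' U' : Type v} [Ring A'] [Algebra k A'] [Ring U'] [Algebra k U']
  {H : HopfAlgebroid k A U} {H' : HopfAlgebroid k A' U'}
  {C : Type*} [AddCommGroup C] [Module k C] [Coalgebra k C]

open HopfAlgebroid (baseMod)

theorem Ψ_flip_s_mul (m : Measuring H H' C) (a : A) (v : U) : m.Ψ.flip (H.s a * v) =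
    conv ((LinearMap.mul k U').comp H'.s.toLinearMap) (m.ψ.flip a) (m.Ψ.flip v) := by
  rw [Ψ_flip_mul, Ψ_flip_s, conv_comp_left]

theorem Ψ_flip_tgt_mul (m : Measuring H H' C) (a : A) (v : U) : m.Ψ.flip (H.tgt a * v) =
    conv ((LinearMap.mul k U').comp H'.sR) (m.ψ.flip a) (m.Ψ.flip v) := by
  rw [Ψ_flip_mul, Ψ_flip_tgt, conv_comp_left]

variable [Coalgebra.IsCocomm k C] (m : Measuring H H' C)

/-- `x(p ⊗ q) = x₍₁₎(p) ⊗ x₍₂₎(q)` on `U ⊗_{A_L} U`. -/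
def tensorLHat : H.TensorL →ₗ[k] C →ₗ[k] H'.TensorL :=
  BalTensor.lift ((conv H'.tmulL).compl₁₂ m.Ψ.flip m.Ψ.flip) (by
    intro a p q
    change conv H'.tmulL (m.Ψ.flip (H.tgt a * p)) (m.Ψ.flip q) =
      conv H'.tmulL (m.Ψ.flip p) (m.Ψ.flip (H.s a * q))
    rw [Ψ_flip_tgt_mul, Ψ_flip_s_mul]
    -- Both `A_L`-actions are left multiplications, so the factors come in the order `a, p, q` on
    -- one side and `p, a, q` on the other: cocommutativity is needed already for well-definedness.
    exact conv_left_comm H'.tmulL ((LinearMap.mul k U').comp H'.sR) H'.tmulL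
      ((LinearMap.mul k U').comp H'.s.toLinearMap)
      (fun a p q => BalTensor.mk_balanced (r := H'.rAct) (l := H'.lAct) a p q) _ _ _)

theorem tensorLHat_tmulL (p q : U) :
    m.tensorLHat (H.tmulL p q) = conv H'.tmulL (m.Ψ.flip p) (m.Ψ.flip q) := rfl

theorem tensorLHat_toTensorL (X : U ⊗[k] U) (x : C) :
    m.tensorLHat (H.toTensorL X) x = H'.toTensorL (diagAct m.Ψ x X) := by
  induction X with
  | zero => simp
  | add a b ha hb => simp only [map_add, LinearMap.add_apply, ha, hb]
  | tmul p q =>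
    change m.tensorLHat (H.tmulL p q) x = _
    rw [tensorLHat_tmulL, conv_apply', diagAct]
    induction Coalgebra.comul (R := k) x with
    | zero => simp
    | add a b ha hb => simp only [map_add, LinearMap.add_apply, ha, hb]
    | tmul c d => rfl

/-- The axiom `map_Δ` speaks of representatives in `U ⊗_k U`. As `tensorLHat` is defined on the
quotient, any one representative of `Δ(u)` turns it into an identity of maps on `C`. -/
theorem tensorLHat_Δ (u : U) : m.tensorLHat (H.Δ u) = H'.Δ.comp (m.Ψ.flip u) := by
  ext x
  obtain ⟨X, hX⟩ := Submodule.mkQ_surjective _ (H.Δ u)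
  rw [← hX, tensorLHat_toTensorL]
  exact (m.map_Δ x u X hX).symm

namespace ModMeasuring

variable {m} {N : LeftMod k U} {N' : LeftMod k U'} (h : m.ModMeasuring N N')

/-- `x(v ⊗ n) = x₍₁₎(v) ⊗ x₍₂₎(n)` on `TensorFlip N`. -/
def flipHat : H.TensorFlip N →ₗ[k] C →ₗ[k] H'.TensorFlip N' :=
  BalTensor.lift ((conv (H'.tmulFlip N')).compl₁₂ m.Ψ.flip h.hat) (by
    intro a p n
    change conv (H'.tmulFlip N') (m.Ψ.flip (H.s a * p)) (h.hat n) =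
      conv (H'.tmulFlip N') (m.Ψ.flip p) (h.hat (N.act (H.tgt a) n))
    rw [Ψ_flip_s_mul, h.hat_tgt]
    -- As for `tensorLHat`, the scalar `s(a)` stands to the left of `p` and has to be moved past it.
    exact conv_left_comm (H'.tmulFlip N') ((LinearMap.mul k U').comp H'.s.toLinearMap)
      (H'.tmulFlip N') (N'.act.toLinearMap.comp H'.sR)
      (fun a p n => H'.tmulFlip_balanced N' a p n) _ _ _)

theorem hat_antipodeTensor (z : H.TensorFlip N) :
    h.tensor.hat (H.antipodeTensor N z) = (H'.antipodeTensor N').comp (h.flipHat z) := by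
  refine BalTensor.apply_ext (f := h.tensorHat.comp (H.antipodeTensor N))
    (g := (LinearMap.llcomp k C _ _ (H'.antipodeTensor N')).comp h.flipHat) (fun v n => ?_) z
  change conv (H'.tmulR N') (m.Ψ.flip (H.S v)) (h.hat n) =
    (H'.antipodeTensor N').comp (conv (H'.tmulFlip N') (m.Ψ.flip v) (h.hat n))
  rw [Ψ_flip_S]
  exact (comp_conv_left _ _ _ H'.S (fun _ _ => rfl) _ _).symm

theorem hat_antipodeTensor_comp {P : LeftMod k U} {P' : LeftMod k U'}
    (h' : m.ModMeasuring P P') (f : P.carrier →ₗ[k] H.TensorFlip N)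
    (f' : P'.carrier →ₗ[k] H'.TensorFlip N')
    (hf : ∀ n, h.flipHat (f n) = f'.comp (h'.hat n)) (n : P.carrier) :
    h.tensor.hat ((H.antipodeTensor N).comp f n) =
      ((H'.antipodeTensor N').comp f').comp (h'.hat n) := by
  rw [LinearMap.comp_apply, hat_antipodeTensor, hf, LinearMap.comp_assoc]

/-- On `z = p ⊗ q` the factors appear as `q, v, p` on the left and `p, q, v` on the right; one
exchange of `p` with the product `q v`, then associativity, matches them. -/
theorem flipHat_splitAux₀ (v : U) (z : H.TensorL) :
    (base m).flipHat (H.splitAux₀ v z) =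
      conv H'.splitAuxBil₀ (m.tensorLHat z) (m.Ψ.flip v) := by
  refine BalTensor.apply_ext (f := (base m).flipHat.comp (H.splitAux₀ v))
    (g := ((conv H'.splitAuxBil₀).flip (m.Ψ.flip v)).comp m.tensorLHat) (fun p q => ?_) z
  change conv (H'.tmulFlip (baseMod k U')) (m.Ψ.flip (q * v)) (m.Ψ.flip p) =
    conv H'.splitAuxBil₀ (conv H'.tmulL (m.Ψ.flip p) (m.Ψ.flip q)) (m.Ψ.flip v)
  rw [conv_comm (H'.tmulFlip (baseMod k U')), Ψ_flip_mul]
  exact (conv_assoc H'.splitAuxBil₀ H'.tmulL (H'.tmulFlip (baseMod k U')).flip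
    (LinearMap.mul k U') (fun p q v => rfl) _ _ _).symm

theorem flipHat_splitBaseMap (z : H.TensorR (baseMod k U)) :
    (base m).flipHat (H.splitBaseMap z) = H'.splitBaseMap.comp ((base m).tensor.hat z) := by
  refine BalTensor.apply_ext (f := (base m).flipHat.comp H.splitBaseMap)
    (g := (LinearMap.llcomp k C _ _ H'.splitBaseMap).comp (base m).tensorHat) (fun u v => ?_) z
  change (base m).flipHat (H.splitBaseMap (H.tmulR (baseMod k U) u v)) =
    H'.splitBaseMap.comp (conv (H'.tmulR (baseMod k U')) (m.Ψ.flip u) (m.Ψ.flip v))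
  rw [HopfAlgebroid.splitBaseMap_tmulR, flipHat_splitAux₀, tensorLHat_Δ]
  exact (comp_conv_left _ _ _ H'.Δ (fun u v => H'.splitBaseMap_tmulR u v) _ _).symm

theorem flipHat_splitAux (v : U) (n : N.carrier) (z : H.TensorL) :
    h.tensor.flipHat (H.splitAux N v n z) = conv (H'.splitAuxBil N') (m.tensorLHat z)
      (conv (TensorProduct.mk k U' N'.carrier) (m.Ψ.flip v) (h.hat n)) := by
  refine BalTensor.apply_ext (f := h.tensor.flipHat.comp (H.splitAux N v n))
    (g := ((conv (H'.splitAuxBil N')).flip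
      (conv (TensorProduct.mk k U' N'.carrier) (m.Ψ.flip v) (h.hat n))).comp m.tensorLHat)
    (fun p q => ?_) z
  change conv (H'.tmulFlip (H'.tensorMod N')) (m.Ψ.flip (q * v))
      (conv (H'.tmulR N') (m.Ψ.flip p) (h.hat n)) =
    conv (H'.splitAuxBil N') (conv H'.tmulL (m.Ψ.flip p) (m.Ψ.flip q))
      (conv (TensorProduct.mk k U' N'.carrier) (m.Ψ.flip v) (h.hat n))
  -- The order `p, q, v, n` has to become `q, v, p, n`. Regroup as `p` against `q v ⊗ n`, exchange
  -- these two, reassociate to `q v` against the pair `n, p`, and exchange `n` with `p`.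
  rw [Ψ_flip_mul, conv_assoc (H'.splitAuxBil N') H'.tmulL (H'.insertBil N')
      ((LinearMap.rTensorHom N'.carrier).comp (LinearMap.mul k U'))
      (fun p q w => H'.splitAuxBil_tmulL N' p q w),
    ← conv_assoc (TensorProduct.mk k U' N'.carrier) (LinearMap.mul k U')
      ((LinearMap.rTensorHom N'.carrier).comp (LinearMap.mul k U'))
      (TensorProduct.mk k U' N'.carrier) (fun q v n => rfl),
    conv_comm (H'.insertBil N')]
  refine Eq.symm ?_
  rw [conv_assoc (H'.insertBil N').flip (TensorProduct.mk k U' N'.carrier)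
    (H'.tmulFlip (H'.tensorMod N')) (H'.tmulR N').flip (fun v n p => rfl),
    conv_comm (H'.tmulR N').flip]
  rfl

theorem flipHat_splitMap (u : U) (z : H.TensorFlip N) :
    h.tensor.flipHat (H.splitMap N u z) =
      conv (H'.splitBil N') (m.Ψ.flip u) (h.flipHat z) := by
  refine BalTensor.apply_ext (f := h.tensor.flipHat.comp (H.splitMap N u))
    (g := (conv (H'.splitBil N') (m.Ψ.flip u)).comp h.flipHat) (fun v n => ?_) z
  change h.tensor.flipHat (H.splitAux N v n (H.Δ u)) =
    conv (H'.splitBil N') (m.Ψ.flip u) (conv (H'.tmulFlip N') (m.Ψ.flip v) (h.hat n))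
  -- Moving `Δ'` into the bilinear map yields `splitAuxBil ∘ Δ'`, which is `splitBil` preceded by
  -- the projection of `U' ⊗_k N'`; that projection is then absorbed by the inner convolution.
  rw [flipHat_splitAux, tensorLHat_Δ, conv_comp_left, ← H'.splitBil_compl₂_mkQ,
    ← conv_comp_right, comp_conv _ (H'.tmulFlip N') _ (fun _ _ => rfl)]

/-- Prepending a factor `u` to a compatible splitting keeps it compatible, the inductive step for
`flipHat_split`. -/
theorem flipHat_splitStepMap {P : LeftMod k U} {P' : LeftMod k U'} (h' : m.ModMeasuring P P')
    (f : H.HomFlip N P) (f' : H'.HomFlip N' P')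
    (hf : ∀ n, h'.flipHat (f.1 n) = f'.1.comp (h.hat n)) (z : H.TensorR N) :
    h'.tensor.flipHat (H.splitStepMap f z) = (H'.splitStepMap f').comp (h.tensor.hat z) := by
  refine BalTensor.apply_ext (f := h'.tensor.flipHat.comp (H.splitStepMap f))
    (g := (LinearMap.llcomp k C _ _ (H'.splitStepMap f')).comp h.tensorHat) (fun u n => ?_) z
  change h'.tensor.flipHat (H.splitMap P u (f.1 n)) =
    (H'.splitStepMap f').comp (conv (H'.tmulR N') (m.Ψ.flip u) (h.hat n))
  rw [flipHat_splitMap, hf]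
  exact (comp_conv_right _ _ _ f'.1 (fun u n => H'.splitStepMap_tmulR f' u n) _ _).symm

theorem flipHat_split (m : Measuring H H' C) : ∀ (n : ℕ) (z : (H.pow (n + 1)).carrier),
    (pow m n).flipHat ((H.split n).1 z) = (H'.split n).1.comp ((pow m (n + 1)).hat z)
  | 0 => flipHat_splitBaseMap
  | n + 1 => (pow m (n + 1)).flipHat_splitStepMap (pow m n) _ _ (flipHat_split m n)

end ModMeasuring

theorem chainHat_cyc : ∀ (n : ℕ) (z : H.Chain n),
    m.chainHat n (H.cyc n z) = (H'.cyc n).comp (m.chainHat n z)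
  | 0, _ => rfl
  | 1, z => m.Ψ_flip_S z
  | n + 2, z => (ModMeasuring.pow m n).hat_antipodeTensor_comp (ModMeasuring.pow m (n + 1)) _ _
      (ModMeasuring.flipHat_split m n) z

/-- The identities are already known as equalities of maps on `C`; evaluating them at `x` gives the
morphism. -/
theorem chainHat_flip_isMorphism (x : C) :
    CyclicOperators.IsMorphism (Z := H.cyclic) (Z' := H'.cyclic)
      (fun n => (m.chainHat n).flip x) where
  map_d n i z := LinearMap.congr_fun (m.chainHat_face n i z) x
  map_s n i z := LinearMap.congr_fun (m.chainHat_degen n i z) x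
  map_t n z := LinearMap.congr_fun (m.chainHat_cyc n z) x

end Measuring

end HopfMeas

end

open HopfMeas in
theorem proposition3p3 {k : Type*} [Field k]
    {A U : Type u} [Ring A] [Algebra k A] [Ring U] [Algebra k U]
    {A' U' : Type v} [Ring A'] [Algebra k A'] [Ring U'] [Algebra k U']
    (H : HopfAlgebroid k A U) (H' : HopfAlgebroid k A' U')
    {C : Type*} [AddCommGroup C] [Module k C] [Coalgebra k C] [Coalgebra.IsCocomm k C]
    (m : Measuring H H' C) (x : C) :
    ∃ φ : ∀ n, H.cyclic.X n →ₗ[k] H'.cyclic.X n,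
      (∀ a : A, φ 0 a = m.ψ x a) ∧
      (∀ (n : ℕ) (u : Fin (n + 1) → U), φ (n + 1) (H.tprod n u) = m.tensorAct n u x) ∧
      CyclicOperators.IsMorphism φ ∧
      (∀ n, InducesOnHomology H.cyclic.b H'.cyclic.b φ n) ∧
      (∀ n, InducesOnHomology (X := H.cyclic.Tot) (Y := H'.cyclic.Tot) H.cyclic.totD
        H'.cyclic.totD (CyclicOperators.totMap φ) n) := by
  have hφ := m.chainHat_flip_isMorphism x
  exact ⟨fun n => (m.chainHat n).flip x, fun a => rfl,
    fun n u => LinearMap.congr_fun (Measuring.ModMeasuring.pow_hat_tprod m n u) x, hφ,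
    inducesOnHomology_of_comm _ _ _ hφ.map_b,
    inducesOnHomology_of_comm (X := H.cyclic.Tot) (Y := H'.cyclic.Tot) _ _ _ hφ.map_totD⟩
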